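/- Let $\mathbf D$ be a finite algebra with more than one element which has a bounded lattice reduct $\langle D,\wedge,\vee,0,1\rangle$ and is semi-primal, i.e. for every $n\ge 1$ every operation $D^n\to D$ that preserves all subalgebras of $\mathbf D$ is term-definable. Hence for $d\in D$ the operation $T_d(x)=1$ if $x=d$, $T_d(x)=0$ otherwise, is given by a unary term. Let $\mathcal A=\mathbb{HSP}(\mathbf D)$ be the variety generated by $\mathbf D$ and $\mathbb S(\mathbf D)$ the set of subalgebras of $\mathbf D$, ordered by inclusion. *Notation.* - $\mathsf{Set}_{\mathbf D}$ has as objects the pairs $(X,v)$ with $X$ a set and $v\colon X\to\mathbb S(\mathbf D)$, and as morphisms $(X_1,v_1)\to(X_2,v_2)$ the maps $f$ with $v_2(f(x))\le v_1(x)$ for all $x$. $\mathsf U\colon\mathsf{Set}_{\mathbf D}\to\mathsf{Set}$ is the forgetful functor. - $\mathsf P\colon\mathsf{Set}\to\mathsf{BA}$ is the contravariant powerset functor; $\mathsf P'\colon\mathsf{Set}_{\mathbf D}\to\mathcal A$ is the contravariant functor $\mathsf P'(X,v)=\prod_{x\in X}v(x)$, $\mathsf P'f(\alpha)=\alpha\circ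 f$. - For $\mathbf S\in\mathbb S(\mathbf D)$: $\mathsf V^{\mathbf S}(X)=(X,\text{constant map }\mathbf S)$; $\mathsf C^{\mathbf S}(X,v)=\{x\in X\mid v(x)\le\mathbf S\}$; $\mathfrak P_{\mathbf S}(\mathbf B)=\mathbf S[\mathbf B]$ is the Boolean power. - The Boolean skeleton $\mathfrak S(\mathbf A)$ is the Boolean algebra $\{a\in A\mid T_1(a)=a\}$ with the lattice operations of $\mathbf A$ and negation $T_0$. $\mathsf K_{\mathbf S}(\mathbf A)=\mathfrak S(\mathbf A/\theta_{\mathbf S})$, where $\theta_{\mathbf S}$ identifies $a,b$ iff $u(a)=u(b)$ for all homomorphisms $u\colon\mathbf A\to\mathbf D$ with image contained in $\mathbf S$. A classical abstract coalgebraic logic for $\mathsf T\colon\mathsf{Set}\to\mathsf{Set}$ is a pair $(\mathsf L,\delta)$ of a functor $\mathsf L\colon\mathsf{BA}\to\mathsf{BA}$ and a natural transformation $\delta\colon\mathsf{LP}\Rightarrow\mathsf{PT}$. Its lifting $(\mathsf L',\delta')$ consists of $$\mathsf L'(\mathbf A)=\int_{\mathbf S\in\mathbb S(\mathbf D)}\mathfrak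 P_{\mathbf S}\mathsf L\mathsf K_{\mathbf S}(\mathbf A)$$ and of the natural transformation $\delta'\colon\mathsf L'\mathsf P'\Rightarrow\mathsf P'\mathsf T'$, where $$\mathsf T'(X,v)=\int^{\mathbf S\in\mathbb S(\mathbf D)}\mathsf V^{\mathbf S}\mathsf T\mathsf C^{\mathbf S}(X,v)$$ and $\delta'_{(X,v)}$ is the unique homomorphism whose composite with $\mathsf P'$ of the coend morphism $\mathsf V^{\mathbf S}\mathsf T\mathsf C^{\mathbf S}(X,v)\to\mathsf T'(X,v)$ is, for every $\mathbf S$, the composite $$\mathsf L'\mathsf P'(X,v)\to\mathfrak P_{\mathbf S}\mathsf L\mathsf K_{\mathbf S}\mathsf P'(X,v)\cong\mathfrak P_{\mathbf S}\mathsf{LP}\mathsf C^{\mathbf S}(X,v)\xrightarrow{\ \mathfrak P_{\mathbf S}\delta\ }\mathfrak P_{\mathbf S}\mathsf{PT}\mathsf C^{\mathbf S}(X,v)\cong\mathsf P'\mathsf V^{\mathbf S}\mathsf T\mathsf C^{\mathbf S}(X,v).$$ Here the first isomorphism sends the class of $\alpha$ to $\{x\in\mathsf C^{\mathbf S}(X,v)\mid\alpha(x)=1\}$,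 and the second sends $\xi$ to the map taking $Z$ to the unique $s\in\mathbf S$ with $Z\in\xi(s)$. A logic is called one-step complete if all components of its natural transformation are monomorphisms. **Theorem.** Let $(\mathsf L,\delta)$ be a classical abstract coalgebraic logic for $\mathsf T\colon\mathsf{Set}\to\mathsf{Set}$ such that $\mathsf L$ and $\mathsf T$ preserve mono- and epimorphisms. If $(\mathsf L,\delta)$ is one-step complete, then so is its lifting $(\mathsf L',\delta')$. Moreover (without assuming one-step completeness), $\mathfrak S\delta'=\delta\mathsf U$ up to natural isomorphism: there are natural isomorphisms $\alpha\colon\mathfrak S\mathsf L'\mathsf P'\cong\mathsf{LPU}$ and $\beta\colon\mathfrak S\mathsf P'\mathsf T'\cong\mathsf{PTU}$ with $\beta\circ\mathfrak S\delta'=\delta\mathsf U\circ\alpha$. -/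

import Mathlib

universe u w w'

namespace SemiPrimal

open FirstOrder FirstOrder.Language FirstOrder.Language.Structure

/-! ### Algebras

Algebras are structures for a language without relation symbols; homomorphisms, subalgebras and
terms are the ones of Mathlib. -/

section Algebras

variable {Ω : FirstOrder.Language.{w, w'}}

/-- The product of a family of algebras, with componentwise operations. -/
instance piStructure {I : Type*} {M : I → Type*} [∀ i, Ω.Structure (M i)] :
    Ω.Structure (∀ i, M i) where
  funMap g x := fun i => funMap g fun k => x k i
  RelMap r x := ∀ i, RelMap r fun k => x k i

theorem pi_funMap_apply {I : Type*} {M : I → Type*} [∀ i, Ω.Structure (M i)] {n : ℕ}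
    (g : Ω.Functions n) (x : Fin n → ∀ i, M i) (i : I) :
    funMap g x i = funMap g fun k => x k i := rfl

theorem coe_funMap {M : Type*} [Ω.Structure M] (S : Ω.Substructure M) {n : ℕ}
    (g : Ω.Functions n) (x : Fin n → S) :
    ((funMap g x : S) : M) = funMap g fun k => (x k : M) := rfl

/-- A map compatible with all operations is a homomorphism. -/
def homMk [Ω.IsAlgebraic] {A B : Type*} [Ω.Structure A] [Ω.Structure B] (f : A → B)
    (h : ∀ (n : ℕ) (g : Ω.Functions n) (x : Fin n → A),
      f (funMap g x) = funMap g fun k => f (x k)) : A →[Ω] B where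
  toFun := f
  map_fun' g x := h _ g x
  map_rel' r := isEmptyElim r

@[simp]
theorem homMk_apply [Ω.IsAlgebraic] {A B : Type*} [Ω.Structure A] [Ω.Structure B] (f : A → B)
    (h : ∀ (n : ℕ) (g : Ω.Functions n) (x : Fin n → A),
      f (funMap g x) = funMap g fun k => f (x k)) (a : A) : homMk f h a = f a := rfl

/-- The evaluation of a product at a coordinate. -/
def piEval [Ω.IsAlgebraic] {I : Type*} {M : I → Type*} [∀ i, Ω.Structure (M i)] (i : I) :
    (∀ i, M i) →[Ω] M i :=
  homMk (fun x => x i) fun _ _ _ => rfl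

variable (Ω) (D : Type u) [Ω.Structure D]

/-- `A` is a homomorphic image of a subalgebra of a power of `D`, that is, `A` belongs to the
variety generated by `D`. -/
def InHSP (A : Type u) [Ω.Structure A] : Prop :=
  ∃ (I : Type u) (C : Ω.Substructure (I → D)) (f : C →[Ω] A), Function.Surjective f

/-- An operation is term-definable. -/
def TermDefinable {n : ℕ} (f : (Fin n → D) → D) : Prop :=
  ∃ t : Ω.Term (Fin n), ∀ x, t.realize x = f x

/-- An operation preserves subalgebras. -/
def PreservesSubalgebras {n : ℕ} (f : (Fin n → D) → D) : Prop :=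
  ∀ (S : Ω.Substructure D) (x : Fin n → D), (∀ i, x i ∈ S) → f x ∈ S

/-- Semi-primality of a (finite) algebra: every operation of positive arity that preserves
subalgebras is term-definable. -/
class IsSemiPrimal : Prop where
  termDefinable : ∀ n : ℕ, 1 ≤ n → ∀ f : (Fin n → D) → D,
    PreservesSubalgebras Ω D f → TermDefinable Ω D f

/-- The bounded lattice structure of `D` is given by terms; in particular this covers the case
where `∧`, `∨`, `0`, `1` are basic operations of `D`. -/
class HasBoundedLatticeReduct [Lattice D] [BoundedOrder D] : Prop where
  inf : TermDefinable Ω D fun x : Fin 2 → D => x 0 ⊓ x 1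
  sup : TermDefinable Ω D fun x : Fin 2 → D => x 0 ⊔ x 1
  bot : TermDefinable Ω D fun _ : Fin 0 → D => ⊥
  top : TermDefinable Ω D fun _ : Fin 0 → D => ⊤

variable {Ω D} [Ω.IsAlgebraic]

theorem InHSP.of_surjective {A B : Type u} [Ω.Structure A] [Ω.Structure B] (hA : InHSP Ω D A)
    (f : A →[Ω] B) (hf : Function.Surjective f) : InHSP Ω D B := by
  obtain ⟨I, C, g, hg⟩ := hA
  exact ⟨I, C, f.comp g, hf.comp hg⟩

theorem InHSP.of_injective {A B : Type u} [Ω.Structure A] [Ω.Structure B] (hA : InHSP Ω D A)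
    (f : B →[Ω] A) (hf : Function.Injective f) : InHSP Ω D B := by
  obtain ⟨I, C, g, hg⟩ := hA
  let C' : Ω.Substructure (I → D) := (f.range.comap g).map C.subtype.toHom
  have key : ∀ c : C', ∃ b : B, ∃ hc : (c : I → D) ∈ C, f b = g ⟨c, hc⟩ := by
    rintro ⟨c, hc⟩
    obtain ⟨c, hc, rfl⟩ := hc
    obtain ⟨b, hb⟩ := hc
    exact ⟨b, c.2, hb⟩
  choose h hC hh using key
  refine ⟨I, C', homMk h ?_, ?_⟩
  · intro n s x
    apply hf
    rw [hh, f.map_fun]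
    have : (f ∘ fun k => h (x k)) = g ∘ fun k => ⟨(x k : I → D), hC (x k)⟩ := by
      funext k
      exact hh (x k)
    rw [this, ← g.map_fun]
    rfl
  · intro b
    obtain ⟨c, hc⟩ := hg (f b)
    refine ⟨⟨c, c, ⟨b, hc.symm⟩, rfl⟩, ?_⟩
    apply hf
    rw [homMk_apply, hh]
    exact hc

theorem InHSP.pi {J : Type u} {A : J → Type u} [∀ j, Ω.Structure (A j)]
    (hA : ∀ j, InHSP Ω D (A j)) : InHSP Ω D (∀ j, A j) := by
  choose I C f hf using hA
  let E : Ω.Substructure ((Σ j, I j) → D) :=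
    { carrier := {x | ∀ j, (fun i => x ⟨j, i⟩) ∈ C j}
      fun_mem := fun g x hx j => (C j).fun_mem g (fun k i => x k ⟨j, i⟩) fun k => hx k j }
  refine ⟨Σ j, I j, E, homMk (fun x j => f j ⟨fun i => x.1 ⟨j, i⟩, x.2 j⟩) ?_, ?_⟩
  · intro n g x
    funext j
    exact (f j).map_fun g fun k => ⟨fun i => (x k).1 ⟨j, i⟩, (x k).2 j⟩
  · intro a
    choose c hc using fun j => hf j (a j)
    refine ⟨⟨fun p => (c p.1).1 p.2, fun j => (c j).2⟩, ?_⟩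
    funext j
    exact hc j

theorem InHSP.self : InHSP Ω D D :=
  ⟨PUnit, ⊤, homMk (fun x => x.1 PUnit.unit) fun _ _ _ => rfl,
    fun d => ⟨⟨fun _ => d, trivial⟩, rfl⟩⟩

end Algebras

section Unary

variable (Ω : FirstOrder.Language.{w, w'}) (D : Type u) [Ω.Structure D] [Lattice D] [BoundedOrder D]

open scoped Classical in
/-- The unary operation `T_d`, the characteristic function of `d`. -/
noncomputable def charFun (d : D) (x : D) : D := if x = d then ⊤ else ⊥

variable [IsSemiPrimal Ω D] [HasBoundedLatticeReduct Ω D]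

/-- A term defining `∧`. -/
noncomputable def infTerm : Ω.Term (Fin 2) :=
  (HasBoundedLatticeReduct.inf (Ω := Ω) (D := D)).choose

/-- A term defining `∨`. -/
noncomputable def supTerm : Ω.Term (Fin 2) :=
  (HasBoundedLatticeReduct.sup (Ω := Ω) (D := D)).choose

/-- A term defining `0`. -/
noncomputable def botTerm : Ω.Term (Fin 0) :=
  (HasBoundedLatticeReduct.bot (Ω := Ω) (D := D)).choose

/-- A term defining `1`. -/
noncomputable def topTerm : Ω.Term (Fin 0) :=
  (HasBoundedLatticeReduct.top (Ω := Ω) (D := D)).choose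

theorem bot_mem (S : Ω.Substructure D) : (⊥ : D) ∈ S := by
  obtain ⟨t, ht⟩ := HasBoundedLatticeReduct.bot (Ω := Ω) (D := D)
  have h := ht Fin.elim0
  dsimp only at h
  rw [← h]
  exact t.realize_mem _ fun i => i.elim0

theorem top_mem (S : Ω.Substructure D) : (⊤ : D) ∈ S := by
  obtain ⟨t, ht⟩ := HasBoundedLatticeReduct.top (Ω := Ω) (D := D)
  have h := ht Fin.elim0
  dsimp only at h
  rw [← h]
  exact t.realize_mem _ fun i => i.elim0

theorem charFun_termDefinable (d : D) :
    TermDefinable Ω D fun x : Fin 1 → D => charFun D d (x 0) := by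
  refine IsSemiPrimal.termDefinable 1 le_rfl _ fun S x _ => ?_
  unfold charFun
  split_ifs
  exacts [top_mem Ω D S, bot_mem Ω D S]

/-- A term defining `T_d`. -/
noncomputable def charTerm (d : D) : Ω.Term (Fin 1) :=
  (charFun_termDefinable Ω D d).choose

/-- The term operation `T_d` on an algebra `A`. -/
noncomputable def charOp {A : Type*} [Ω.Structure A] (d : D) (a : A) : A :=
  (charTerm Ω D d).realize ![a]

/-- The term operation `∧` on an algebra `A`. -/
noncomputable def infOp {A : Type*} [Ω.Structure A] (a b : A) : A :=
  (infTerm Ω D).realize ![a, b]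

/-- The term operation `∨` on an algebra `A`. -/
noncomputable def supOp {A : Type*} [Ω.Structure A] (a b : A) : A :=
  (supTerm Ω D).realize ![a, b]

/-- The constant `0` of an algebra `A`. -/
noncomputable def botOp (A : Type*) [Ω.Structure A] : A :=
  (botTerm Ω D).realize ![]

/-- The constant `1` of an algebra `A`. -/
noncomputable def topOp (A : Type*) [Ω.Structure A] : A :=
  (topTerm Ω D).realize ![]

@[simp] theorem charOp_self (d x : D) : charOp Ω D d x = charFun D d x :=
  (charFun_termDefinable Ω D d).choose_spec ![x]

@[simp] theorem infOp_self (x y : D) : infOp Ω D x y = x ⊓ y :=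
  (HasBoundedLatticeReduct.inf (Ω := Ω) (D := D)).choose_spec ![x, y]

@[simp] theorem supOp_self (x y : D) : supOp Ω D x y = x ⊔ y :=
  (HasBoundedLatticeReduct.sup (Ω := Ω) (D := D)).choose_spec ![x, y]

@[simp] theorem botOp_self : botOp Ω D D = ⊥ :=
  (HasBoundedLatticeReduct.bot (Ω := Ω) (D := D)).choose_spec ![]

@[simp] theorem topOp_self : topOp Ω D D = ⊤ :=
  (HasBoundedLatticeReduct.top (Ω := Ω) (D := D)).choose_spec ![]

variable {A B : Type*} [Ω.Structure A] [Ω.Structure B]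

theorem map_charOp (f : A →[Ω] B) (d : D) (a : A) :
    f (charOp Ω D d a) = charOp Ω D d (f a) := by
  unfold charOp
  rw [← HomClass.realize_term f]
  congr 1
  funext i
  fin_cases i; rfl

theorem map_infOp (f : A →[Ω] B) (a b : A) : f (infOp Ω D a b) = infOp Ω D (f a) (f b) := by
  unfold infOp
  rw [← HomClass.realize_term f]
  congr 1
  funext i
  fin_cases i <;> rfl

theorem map_supOp (f : A →[Ω] B) (a b : A) : f (supOp Ω D a b) = supOp Ω D (f a) (f b) := by
  unfold supOp
  rw [← HomClass.realize_term f]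
  congr 1
  funext i
  fin_cases i <;> rfl

theorem map_botOp (f : A →[Ω] B) : f (botOp Ω D A) = botOp Ω D B := by
  unfold botOp
  rw [← HomClass.realize_term f]
  congr 1
  funext i
  exact i.elim0

theorem map_topOp (f : A →[Ω] B) : f (topOp Ω D A) = topOp Ω D B := by
  unfold topOp
  rw [← HomClass.realize_term f]
  congr 1
  funext i
  exact i.elim0

end Unary

section Variety

open CategoryTheory CategoryTheory.Limits Opposite

variable (Ω : FirstOrder.Language.{w, w'}) [Ω.IsAlgebraic] (D : Type u) [Ω.Structure D]

/-- The objects of the variety `HSP(D)`. -/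
structure Var where
  /-- The carrier of an algebra. -/
  carrier : Type u
  [str : Ω.Structure carrier]
  mem : InHSP Ω D carrier

attribute [instance] Var.str

instance : CoeSort (Var Ω D) (Type u) := ⟨Var.carrier⟩

/-- The variety generated by `D`, as a category with all homomorphisms. -/
instance : Category (Var Ω D) where
  Hom A B := A →[Ω] B
  id A := FirstOrder.Language.Hom.id Ω A
  comp f g := FirstOrder.Language.Hom.comp g f

variable {Ω D}

/-- The homomorphism underlying a morphism. -/
def Var.hom {A B : Var Ω D} (f : A ⟶ B) : A →[Ω] B := f

/-- A homomorphism as a morphism. -/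
def Var.ofHom {A B : Var Ω D} (f : A →[Ω] B) : A ⟶ B := f

@[simp] theorem Var.hom_ofHom {A B : Var Ω D} (f : A →[Ω] B) : Var.hom (Var.ofHom f) = f := rfl

@[simp] theorem Var.hom_id (A : Var Ω D) (a : A) : Var.hom (𝟙 A) a = a := rfl

@[simp] theorem Var.hom_comp {A B C : Var Ω D} (f : A ⟶ B) (g : B ⟶ C) (a : A) :
    Var.hom (f ≫ g) a = Var.hom g (Var.hom f a) := rfl

theorem Var.ext {A B : Var Ω D} {f g : A ⟶ B} (h : ∀ a, Var.hom f a = Var.hom g a) : f = g :=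
  FirstOrder.Language.Hom.ext h

theorem Var.congr_hom {A B : Var Ω D} {f g : A ⟶ B} (h : f = g) (a : A) :
    Var.hom f a = Var.hom g a := by rw [h]

/-- The limit of a diagram, as the subalgebra of compatible families of the product. -/
def Var.limSub {J : Type u} [SmallCategory J] (F : J ⥤ Var Ω D) :
    Ω.Substructure (∀ j, F.obj j) where
  carrier := {x | ∀ ⦃i j : J⦄ (f : i ⟶ j), Var.hom (F.map f) (x i) = x j}
  fun_mem g x hx i j f := by
    rw [pi_funMap_apply, (Var.hom (F.map f)).map_fun]
    exact congrArg (funMap g) (funext fun k => hx k f)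

instance : HasLimitsOfSize.{u, u} (Var Ω D) where
  has_limits_of_shape J _ :=
    { has_limit := fun F => ⟨⟨
        { cone :=
            { pt :=
                { carrier := Var.limSub F
                  mem := (InHSP.pi fun j => (F.obj j).mem).of_injective
                    (Var.limSub F).subtype.toHom Subtype.val_injective }
              π :=
                { app := fun j => Var.ofHom (homMk (fun x => x.1 j) fun _ _ _ => rfl)
                  naturality := fun i j f => Var.ext fun x => (x.2 f).symm } }
          isLimit :=
            { lift := fun s => Var.ofHom (homMk
                (fun a => ⟨fun j => Var.hom (s.π.app j) a, fun i j f =>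
                  Var.congr_hom (s.w f) a⟩)
                fun n g x => Subtype.ext (funext fun j => (Var.hom (s.π.app j)).map_fun g x))
              fac := fun s j => rfl
              uniq := fun s m hm => Var.ext fun a => Subtype.ext (funext fun j =>
                Var.congr_hom (hm j) a) } }⟩⟩ }

end Variety

section Skeleton

open CategoryTheory

variable (Ω : FirstOrder.Language.{w, w'}) [Ω.IsAlgebraic] (D : Type u) [Ω.Structure D]
  [Lattice D] [BoundedOrder D] [IsSemiPrimal Ω D] [HasBoundedLatticeReduct Ω D]

theorem exists_lift {A : Type u} [Ω.Structure A] (hA : InHSP Ω D A) :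
    ∃ (I : Type u) (C : Ω.Substructure (I → D)) (f : C →[Ω] A),
      ∀ a : A, charOp Ω D ⊤ a = a → ∃ c : C, (∀ i, c.1 i = ⊤ ∨ c.1 i = ⊥) ∧ f c = a := by
  obtain ⟨I, C, f, hf⟩ := hA
  refine ⟨I, C, f, fun a ha => ?_⟩
  obtain ⟨c, rfl⟩ := hf a
  refine ⟨charOp Ω D ⊤ c, fun i => ?_, by rw [map_charOp, ha]⟩
  have h := map_charOp Ω D ((piEval (Ω := Ω) i).comp C.subtype.toHom) ⊤ c
  have h' : (charOp Ω D ⊤ c).1 i = charFun D ⊤ (c.1 i) := h.trans (charOp_self Ω D _ _)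
  rw [h', charFun]
  split_ifs <;> simp

section PowerLemmas

variable {I : Type u} {C : Ω.Substructure (I → D)}

theorem coe_infOp (a b : C) (i : I) : (infOp Ω D a b).1 i = a.1 i ⊓ b.1 i :=
  (map_infOp Ω D ((piEval (Ω := Ω) i).comp C.subtype.toHom) a b).trans (infOp_self Ω D _ _)

theorem coe_supOp (a b : C) (i : I) : (supOp Ω D a b).1 i = a.1 i ⊔ b.1 i :=
  (map_supOp Ω D ((piEval (Ω := Ω) i).comp C.subtype.toHom) a b).trans (supOp_self Ω D _ _)

theorem coe_charOp (d : D) (a : C) (i : I) : (charOp Ω D d a).1 i = charFun D d (a.1 i) :=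
  (map_charOp Ω D ((piEval (Ω := Ω) i).comp C.subtype.toHom) d a).trans (charOp_self Ω D _ _)

theorem coe_botOp (i : I) : (botOp Ω D C).1 i = ⊥ :=
  (map_botOp Ω D ((piEval (Ω := Ω) i).comp C.subtype.toHom)).trans (botOp_self Ω D)

theorem coe_topOp (i : I) : (topOp Ω D C).1 i = ⊤ :=
  (map_topOp Ω D ((piEval (Ω := Ω) i).comp C.subtype.toHom)).trans (topOp_self Ω D)

@[simp] theorem charFun_top_top : charFun D ⊤ (⊤ : D) = ⊤ := by simp [charFun]
@[simp] theorem charFun_bot_bot : charFun D ⊥ (⊥ : D) = ⊤ := by simp [charFun]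
@[simp] theorem charFun_top_bot : charFun D ⊤ (⊥ : D) = ⊥ := by
  unfold charFun
  split_ifs with h
  exacts [h.symm, rfl]
@[simp] theorem charFun_bot_top : charFun D ⊥ (⊤ : D) = ⊥ := by
  unfold charFun
  split_ifs with h
  exacts [h, rfl]

end PowerLemmas

variable {Ω D}

/-- The carrier of the Boolean skeleton of `A`: the elements with `T₁(a) = a`. -/
structure Skel (A : Var Ω D) : Type u where
  /-- The underlying element of `A`. -/
  val : A
  prop : charOp Ω D ⊤ val = val

namespace Skel

variable {A : Var Ω D}

theorem ext {a b : Skel A} (h : a.1 = b.1) : a = b := by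
  cases a; cases b; cases h; rfl

theorem charOp_mem (d : D) (a : A) : charOp Ω D ⊤ (charOp Ω D d a) = charOp Ω D d a := by
  obtain ⟨I, C, f, hf⟩ := A.mem
  obtain ⟨c, rfl⟩ := hf a
  rw [← map_charOp, ← map_charOp]
  congr 1
  refine Subtype.ext (funext fun i => ?_)
  rw [coe_charOp, coe_charOp]
  unfold charFun
  split_ifs <;> simp_all

noncomputable instance : Max (Skel A) := ⟨fun a b => ⟨supOp Ω D a.1 b.1, by
  obtain ⟨I, C, f, hf⟩ := exists_lift Ω D A.mem
  obtain ⟨a, ha⟩ := a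
  obtain ⟨b, hb⟩ := b
  obtain ⟨a, ka, rfl⟩ := hf a ha
  obtain ⟨b, kb, rfl⟩ := hf b hb
  simp only [← map_supOp, ← map_charOp]
  congr 1
  refine Subtype.ext (funext fun i => ?_)
  rw [coe_charOp, coe_supOp]
  rcases ka i with h | h <;> rcases kb i with h' | h' <;> simp [h, h']⟩⟩

noncomputable instance : Min (Skel A) := ⟨fun a b => ⟨infOp Ω D a.1 b.1, by
  obtain ⟨I, C, f, hf⟩ := exists_lift Ω D A.mem
  obtain ⟨a, ha⟩ := a
  obtain ⟨b, hb⟩ := b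
  obtain ⟨a, ka, rfl⟩ := hf a ha
  obtain ⟨b, kb, rfl⟩ := hf b hb
  simp only [← map_infOp, ← map_charOp]
  congr 1
  refine Subtype.ext (funext fun i => ?_)
  rw [coe_charOp, coe_infOp]
  rcases ka i with h | h <;> rcases kb i with h' | h' <;> simp [h, h']⟩⟩

noncomputable instance : Top (Skel A) := ⟨⟨topOp Ω D A, by
  obtain ⟨I, C, f, hf⟩ := exists_lift Ω D A.mem
  rw [← map_topOp Ω D f, ← map_charOp]
  congr 1
  refine Subtype.ext (funext fun i => ?_)
  rw [coe_charOp, coe_topOp, charFun_top_top]⟩⟩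

noncomputable instance : Bot (Skel A) := ⟨⟨botOp Ω D A, by
  obtain ⟨I, C, f, hf⟩ := exists_lift Ω D A.mem
  rw [← map_botOp Ω D f, ← map_charOp]
  congr 1
  refine Subtype.ext (funext fun i => ?_)
  rw [coe_charOp, coe_botOp, charFun_top_bot]⟩⟩

noncomputable instance : Compl (Skel A) := ⟨fun a => ⟨charOp Ω D ⊥ a.1, charOp_mem _ _⟩⟩

theorem coe_sup (a b : Skel A) : (a ⊔ b).1 = supOp Ω D a.1 b.1 := rfl
theorem coe_inf (a b : Skel A) : (a ⊓ b).1 = infOp Ω D a.1 b.1 := rfl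
theorem coe_top : (⊤ : Skel A).1 = topOp Ω D A := rfl
theorem coe_bot : (⊥ : Skel A).1 = botOp Ω D A := rfl
theorem coe_compl (a : Skel A) : (aᶜ).1 = charOp Ω D ⊥ a.1 := rfl

theorem lattice_axioms (A : Var Ω D) : (∀ a b : Skel A, a ⊔ b = b ⊔ a) ∧
    (∀ a b c : Skel A, a ⊔ b ⊔ c = a ⊔ (b ⊔ c)) ∧ (∀ a b : Skel A, a ⊓ b = b ⊓ a) ∧
    (∀ a b c : Skel A, a ⊓ b ⊓ c = a ⊓ (b ⊓ c)) ∧ (∀ a b : Skel A, a ⊔ a ⊓ b = a) ∧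
    (∀ a b : Skel A, a ⊓ (a ⊔ b) = a) := by
  obtain ⟨I, C, f, hf⟩ := exists_lift Ω D A.mem
  refine ⟨?_, ?_, ?_, ?_, ?_, ?_⟩
  all_goals
    rintro ⟨a, ha⟩ ⟨b, hb⟩
    try rintro ⟨c, hc⟩
    obtain ⟨a, ka, rfl⟩ := hf a ha
    obtain ⟨b, kb, rfl⟩ := hf b hb
    try obtain ⟨c, kc, rfl⟩ := hf c hc
    apply ext
    simp only [coe_sup, coe_inf, ← map_supOp, ← map_infOp]
    congr 1
    refine Subtype.ext (funext fun i => ?_)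
    simp only [coe_supOp, coe_infOp]
    first
      | exact sup_comm _ _
      | exact inf_comm _ _
      | exact sup_assoc _ _ _
      | exact inf_assoc _ _ _
      | exact sup_inf_self
      | exact inf_sup_self

noncomputable instance instLattice : Lattice (Skel A) :=
  Lattice.mk' (lattice_axioms A).1 (lattice_axioms A).2.1 (lattice_axioms A).2.2.1
    (lattice_axioms A).2.2.2.1 (lattice_axioms A).2.2.2.2.1 (lattice_axioms A).2.2.2.2.2

theorem le_iff {a b : Skel A} : a ≤ b ↔ a ⊔ b = b := Iff.rfl

/-- The Boolean skeleton, with the inherited lattice operations and the negation `T₀`. -/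
noncomputable instance instBooleanAlgebra : BooleanAlgebra (Skel A) :=
  { instLattice with
    le_sup_inf := by
      obtain ⟨I, C, f, hf⟩ := exists_lift Ω D A.mem
      rintro ⟨a, ha⟩ ⟨b, hb⟩ ⟨c, hc⟩
      obtain ⟨a, ka, rfl⟩ := hf a ha
      obtain ⟨b, kb, rfl⟩ := hf b hb
      obtain ⟨c, kc, rfl⟩ := hf c hc
      refine le_iff.2 (ext ?_)
      simp only [coe_sup, coe_inf, ← map_supOp, ← map_infOp]
      congr 1
      refine Subtype.ext (funext fun i => ?_)
      simp only [coe_supOp, coe_infOp]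
      rcases ka i with h | h <;> rcases kb i with h' | h' <;> rcases kc i with h'' | h'' <;>
        simp [h, h', h'']
    top := ⊤
    bot := ⊥
    compl := compl
    inf_compl_le_bot := by
      obtain ⟨I, C, f, hf⟩ := exists_lift Ω D A.mem
      rintro ⟨a, ha⟩
      obtain ⟨a, ka, rfl⟩ := hf a ha
      refine le_iff.2 (ext ?_)
      simp only [coe_sup, coe_inf, coe_compl, coe_bot, ← map_supOp, ← map_infOp, ← map_charOp,
        ← map_botOp Ω D f]
      congr 1
      refine Subtype.ext (funext fun i => ?_)
      simp only [coe_supOp, coe_infOp, coe_charOp, coe_botOp]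
      rcases ka i with h | h <;> simp [h]
    top_le_sup_compl := by
      obtain ⟨I, C, f, hf⟩ := exists_lift Ω D A.mem
      rintro ⟨a, ha⟩
      obtain ⟨a, ka, rfl⟩ := hf a ha
      refine le_iff.2 (ext ?_)
      simp only [coe_sup, coe_compl, coe_top, ← map_supOp, ← map_charOp,
        ← map_topOp Ω D f]
      congr 1
      refine Subtype.ext (funext fun i => ?_)
      simp only [coe_supOp, coe_charOp, coe_topOp]
      rcases ka i with h | h <;> simp [h]
    le_top := by
      obtain ⟨I, C, f, hf⟩ := exists_lift Ω D A.mem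
      rintro ⟨a, ha⟩
      obtain ⟨a, ka, rfl⟩ := hf a ha
      refine le_iff.2 (ext ?_)
      simp only [coe_sup, coe_top, ← map_supOp, ← map_topOp Ω D f]
      congr 1
      refine Subtype.ext (funext fun i => ?_)
      simp only [coe_supOp, coe_topOp]
      simp
    bot_le := by
      obtain ⟨I, C, f, hf⟩ := exists_lift Ω D A.mem
      rintro ⟨a, ha⟩
      obtain ⟨a, ka, rfl⟩ := hf a ha
      refine le_iff.2 (ext ?_)
      simp only [coe_sup, coe_bot, ← map_supOp, ← map_botOp Ω D f]
      congr 1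
      refine Subtype.ext (funext fun i => ?_)
      simp only [coe_supOp, coe_botOp]
      simp }

/-- The restriction of a homomorphism to Boolean skeletons. -/
noncomputable def map {A B : Var Ω D} (f : A ⟶ B) : BoundedLatticeHom (Skel A) (Skel B) where
  toFun a := ⟨Var.hom f a.1, by rw [← map_charOp, a.2]⟩
  map_sup' a b := ext (map_supOp Ω D (Var.hom f) a.1 b.1)
  map_inf' a b := ext (map_infOp Ω D (Var.hom f) a.1 b.1)
  map_top' := ext (map_topOp Ω D (Var.hom f))
  map_bot' := ext (map_botOp Ω D (Var.hom f))

end Skel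

variable (Ω D) in
/-- The Boolean skeleton functor. -/
noncomputable def skeleton : Var Ω D ⥤ BoolAlg.{u} where
  obj A := BoolAlg.of (Skel A)
  map f := BoolAlg.ofHom (Skel.map f)

end Skeleton

section Quotients

open CategoryTheory Opposite

variable {Ω : FirstOrder.Language.{w, w'}} [Ω.IsAlgebraic] {D : Type u} [Ω.Structure D]

/-- The congruence on `A` of being identified by all homomorphisms `A → D` with image in `S`. -/
def theta (S : Ω.Substructure D) (A : Var Ω D) : Setoid A where
  r a b := ∀ u : A →[Ω] D, (∀ x, u x ∈ S) → u a = u b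
  iseqv :=
    { refl := fun _ _ _ => rfl
      symm := fun h u hu => (h u hu).symm
      trans := fun h h' u hu => (h u hu).trans (h' u hu) }

instance thetaPrestructure (S : Ω.Substructure D) (A : Var Ω D) :
    Ω.Prestructure (theta S A) where
  toStructure := A.str
  fun_equiv {n g} x y h u hu := by
    rw [u.map_fun, u.map_fun]
    exact congrArg (funMap g) (funext fun k => h k u hu)
  rel_equiv {n r} := isEmptyElim r

/-- The canonical homomorphism onto the quotient of `A` by `theta S A`. -/
def thetaMk (S : Ω.Substructure D) (A : Var Ω D) : A →[Ω] Quotient (theta S A) :=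
  homMk (fun a => Quotient.mk _ a) fun _ g x => (funMap_quotient_mk' (theta S A) g x).symm

/-- The quotient of `A` by `theta S A`. -/
def quot (S : Ω.Substructure D) (A : Var Ω D) : Var Ω D where
  carrier := Quotient (theta S A)
  mem := A.mem.of_surjective (thetaMk S A) Quotient.mk_surjective

/-- A homomorphism `A → B` induces a homomorphism between the quotients. -/
def quotHom {S S' : Ω.Substructure D} (h : S' ≤ S) {A B : Var Ω D} (f : A ⟶ B) :
    Quotient (theta S A) →[Ω] Quotient (theta S' B) :=
  homMk
    (Quotient.map (Var.hom f) fun _ _ hab u hu =>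
      hab (FirstOrder.Language.Hom.comp u (Var.hom f)) fun x => h (hu (Var.hom f x)))
    (by
      intro n g x
      obtain ⟨y, rfl⟩ : ∃ y : Fin n → A, x = fun k => Quotient.mk _ (y k) :=
        ⟨fun k => (x k).out, funext fun k => (Quotient.out_eq (x k)).symm⟩
      rw [funMap_quotient_mk' (theta S A) g y]
      refine Eq.trans ?_ (funMap_quotient_mk' (theta S' B) g fun k => Var.hom f (y k)).symm
      exact congrArg (Quotient.mk _) ((Var.hom f).map_fun g y))

/-- The map induced on quotients, as a morphism of the variety. -/
def quotMap {S S' : Ω.Substructure D} (h : S' ≤ S) {A B : Var Ω D} (f : A ⟶ B) :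
    quot S A ⟶ quot S' B :=
  Var.ofHom (A := quot S A) (B := quot S' B) (quotHom h f)

theorem quotMap_mk {S S' : Ω.Substructure D} (h : S' ≤ S) {A B : Var Ω D} (f : A ⟶ B) (a : A) :
    Var.hom (quotMap h f) (Quotient.mk (theta S A) a) =
      Quotient.mk (theta S' B) (Var.hom f a) := rfl

theorem quot_ext {S : Ω.Substructure D} {A B : Var Ω D} {f g : quot S A ⟶ B}
    (h : ∀ a : A, Var.hom f (Quotient.mk (theta S A) a) =
      Var.hom g (Quotient.mk (theta S A) a)) : f = g :=
  Var.ext fun a => Quotient.inductionOn a h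

variable (Ω D) in
/-- The quotient functors, contravariant in the subalgebra. -/
def quotFunctor : (Ω.Substructure D)ᵒᵖ ⥤ Var Ω D ⥤ Var Ω D where
  obj S :=
    { obj := fun A => quot S.unop A
      map := fun f => quotMap le_rfl f
      map_id := fun _ => quot_ext fun _ => rfl
      map_comp := fun _ _ => quot_ext fun _ => rfl }
  map s :=
    { app := fun A => quotMap (leOfHom s.unop) (𝟙 A)
      naturality := fun _ _ _ => quot_ext fun _ => rfl }
  map_id _ := NatTrans.ext (funext fun _ => quot_ext fun _ => rfl)
  map_comp _ _ := NatTrans.ext (funext fun _ => quot_ext fun _ => rfl)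

end Quotients

section BoolPower

open scoped Classical in
/-- Points of a Boolean algebra separate its elements. -/
theorem exists_point {B : Type*} [BooleanAlgebra B] {b c : B} (h : ¬ b ≤ c) :
    ∃ φ : BoundedLatticeHom B Prop, φ b ∧ ¬ φ c := by
  have hd : Disjoint (Order.PFilter.principal b : Set B) (Order.Ideal.principal c : Set B) := by
    rw [Set.disjoint_left]
    intro x hx hx'
    exact h (le_trans (Order.PFilter.mem_principal.1 hx) (Order.Ideal.mem_principal.1 hx'))
  obtain ⟨J, hJ, hcJ, hbJ⟩ := DistribLattice.prime_ideal_of_disjoint_filter_ideal hd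
  refine ⟨{ toFun := fun x => x ∉ J, map_sup' := ?_, map_inf' := ?_, map_top' := ?_,
            map_bot' := ?_ }, ?_, ?_⟩
  · intro x y
    apply propext
    change (x ⊔ y ∉ J) ↔ (x ∉ J ∨ y ∉ J)
    rw [Order.Ideal.sup_mem_iff]
    tauto
  · intro x y
    apply propext
    change (x ⊓ y ∉ J) ↔ (x ∉ J ∧ y ∉ J)
    have h1 := hJ.mem_or_mem (x := x) (y := y)
    have h2 : x ∈ J → x ⊓ y ∈ J := fun h => J.lower inf_le_left h
    have h3 : y ∈ J → x ⊓ y ∈ J := fun h => J.lower inf_le_right h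
    tauto
  · exact propext (iff_true_intro fun ht => hJ.toIsProper.top_notMem ht)
  · exact propext (iff_false_intro fun hn => hn J.bot_mem)
  · exact fun hb => Set.disjoint_left.1 hbJ (Order.PFilter.mem_principal.2 le_rfl) hb
  · exact fun hc => hc (hcJ (Order.Ideal.mem_principal.2 le_rfl))

theorem eq_of_points {B : Type*} [BooleanAlgebra B] {b c : B}
    (h : ∀ φ : BoundedLatticeHom B Prop, φ b ↔ φ c) : b = c := by
  apply le_antisymm
  · by_contra hn
    obtain ⟨φ, h1, h2⟩ := exists_point hn
    exact h2 ((h φ).1 h1)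
  · by_contra hn
    obtain ⟨φ, h1, h2⟩ := exists_point hn
    exact h2 ((h φ).2 h1)

theorem point_sup {B ι : Type*} [BooleanAlgebra B] (φ : BoundedLatticeHom B Prop)
    (s : Finset ι) (f : ι → B) : φ (s.sup f) ↔ ∃ i ∈ s, φ (f i) := by
  rw [map_finset_sup, Finset.sup_eq_iSup]
  simp

theorem point_inf {B ι : Type*} [BooleanAlgebra B] (φ : BoundedLatticeHom B Prop)
    (s : Finset ι) (f : ι → B) : φ (s.inf f) ↔ ∀ i ∈ s, φ (f i) := by
  rw [map_finset_inf, Finset.inf_eq_iInf]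
  simp

variable {Ω : FirstOrder.Language.{w, w'}} {D : Type u} [Ω.Structure D] [Finite D]

/-- The elements of the Boolean power `S[B]`: functions `ξ : S → B` with pairwise disjoint values
whose join is `1`. -/
structure BoolPower (S : Ω.Substructure D) (B : Type u) [BooleanAlgebra B] : Type u where
  /-- The underlying function. -/
  toFun : S → B
  disjoint : ∀ s t : S, s ≠ t → toFun s ⊓ toFun t = ⊥
  cover : IsLUB (Set.range toFun) ⊤

namespace BoolPower

variable {S : Ω.Substructure D} {B : Type u} [BooleanAlgebra B]

theorem ext_toFun {ξ ζ : BoolPower S B} (h : ξ.toFun = ζ.toFun) : ξ = ζ := by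
  cases ξ; cases ζ; cases h; rfl

theorem existsUnique_val (ξ : BoolPower S B) (φ : BoundedLatticeHom B Prop) :
    ∃! s, φ (ξ.toFun s) := by
  have := Fintype.ofFinite S
  have h : φ (Finset.univ.sup ξ.toFun) := by
    have hc : Finset.univ.sup ξ.toFun = ⊤ := top_le_iff.1 (ξ.cover.2 (by
      rintro _ ⟨s, rfl⟩
      exact Finset.le_sup (Finset.mem_univ s)))
    rw [hc, map_top]
    trivial
  obtain ⟨s, -, hs⟩ := (point_sup φ _ _).1 h
  refine ⟨s, hs, fun t ht => ?_⟩
  by_contra hne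
  have h' : φ (ξ.toFun t ⊓ ξ.toFun s) := by
    rw [map_inf]
    exact ⟨ht, hs⟩
  rw [ξ.disjoint t s hne, map_bot] at h'
  exact h'

theorem of_existsUnique {f : S → B} (h : ∀ φ : BoundedLatticeHom B Prop, ∃! s, φ (f s)) :
    (∀ s t : S, s ≠ t → f s ⊓ f t = ⊥) ∧ IsLUB (Set.range f) ⊤ := by
  refine ⟨fun s t hst => eq_of_points fun φ => ?_, fun _ _ => le_top, fun b hb => ?_⟩
  · rw [map_inf, map_bot]
    exact ⟨fun h' => hst ((h φ).unique h'.1 h'.2), fun h' => h'.elim⟩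
  · by_contra hn
    obtain ⟨φ, -, h2⟩ := exists_point hn
    obtain ⟨s, hs, -⟩ := h φ
    exact h2 (OrderHomClass.mono φ (hb ⟨s, rfl⟩) hs)

/-- The value of `ξ` at a point of `B`. -/
noncomputable def val (ξ : BoolPower S B) (φ : BoundedLatticeHom B Prop) : S :=
  (ξ.existsUnique_val φ).choose

theorem val_spec (ξ : BoolPower S B) (φ : BoundedLatticeHom B Prop) : φ (ξ.toFun (ξ.val φ)) :=
  (ξ.existsUnique_val φ).choose_spec.1

theorem val_eq_iff (ξ : BoolPower S B) (φ : BoundedLatticeHom B Prop) (s : S) :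
    ξ.val φ = s ↔ φ (ξ.toFun s) :=
  ⟨fun h => h ▸ ξ.val_spec φ, fun h => (ξ.existsUnique_val φ).unique (ξ.val_spec φ) h⟩

theorem ext_val {ξ ζ : BoolPower S B} (h : ∀ φ, ξ.val φ = ζ.val φ) : ξ = ζ :=
  ext_toFun (funext fun s => eq_of_points fun φ => by rw [← val_eq_iff, ← val_eq_iff, h])

open scoped Classical in
/-- The operation on `S[B]` induced by an operation `g` of `S`:
`g(ξ₁, …, ξₙ)(s) = ⋁ {ξ₁(s₁) ∧ ⋯ ∧ ξₙ(sₙ) | g(s₁, …, sₙ) = s}`. -/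
noncomputable def opFun {n : ℕ} (g : Ω.Functions n) (ξ : Fin n → BoolPower S B) (s : S) : B :=
  letI := Fintype.ofFinite S
  (Finset.univ.filter fun v : Fin n → S => funMap g v = s).sup fun v =>
    Finset.univ.inf fun k => (ξ k).toFun (v k)

theorem point_opFun {n : ℕ} (g : Ω.Functions n) (ξ : Fin n → BoolPower S B) (s : S)
    (φ : BoundedLatticeHom B Prop) :
    φ (opFun g ξ s) ↔ funMap g (fun k => (ξ k).val φ) = s := by
  unfold opFun
  rw [point_sup]
  simp only [Finset.mem_filter, Finset.mem_univ, true_and, point_inf, forall_true_left]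
  constructor
  · rintro ⟨v, hv, h⟩
    rw [← hv]
    exact congrArg (funMap g) (funext fun k => ((ξ k).val_eq_iff φ (v k)).2 (h k))
  · intro h
    exact ⟨_, h, fun k => (ξ k).val_spec φ⟩

theorem existsUnique_opFun {n : ℕ} (g : Ω.Functions n) (ξ : Fin n → BoolPower S B)
    (φ : BoundedLatticeHom B Prop) : ∃! s, φ (opFun g ξ s) :=
  ⟨_, (point_opFun g ξ _ φ).2 rfl, fun s hs => ((point_opFun g ξ s φ).1 hs).symm⟩

noncomputable instance [Ω.IsAlgebraic] : Ω.Structure (BoolPower S B) where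
  funMap g ξ :=
    { toFun := opFun g ξ
      disjoint := (of_existsUnique (existsUnique_opFun g ξ)).1
      cover := (of_existsUnique (existsUnique_opFun g ξ)).2 }
  RelMap r := isEmptyElim r

variable [Ω.IsAlgebraic]

theorem val_funMap {n : ℕ} (g : Ω.Functions n) (ξ : Fin n → BoolPower S B)
    (φ : BoundedLatticeHom B Prop) :
    (funMap g ξ).val φ = funMap g fun k => (ξ k).val φ :=
  ((funMap g ξ).val_eq_iff φ _).2 ((point_opFun g ξ _ φ).2 rfl)

theorem inHSP (S : Ω.Substructure D) (B : Type u) [BooleanAlgebra B] :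
    InHSP Ω D (BoolPower S B) := by
  refine (InHSP.pi (J := BoundedLatticeHom B Prop) fun _ => InHSP.self).of_injective
    (homMk (fun ξ φ => ((ξ.val φ : S) : D)) ?_) ?_
  · intro n g ξ
    funext φ
    rw [val_funMap]
    rfl
  · intro ξ ζ h
    exact ext_val fun φ => Subtype.ext (congrFun h φ)

/-- The action of the Boolean power on homomorphisms of Boolean algebras. -/
def mapFun {B' : Type u} [BooleanAlgebra B'] (h : BoundedLatticeHom B B') (ξ : BoolPower S B) :
    BoolPower S B' where
  toFun s := h (ξ.toFun s)
  disjoint := (of_existsUnique fun φ => ξ.existsUnique_val (φ.comp h)).1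
  cover := (of_existsUnique fun φ => ξ.existsUnique_val (φ.comp h)).2

open scoped Classical in
/-- The inclusion of Boolean powers for `S ≤ S'`: extension by `0`. -/
noncomputable def extFun {S' : Ω.Substructure D} (h : S ≤ S') (ξ : BoolPower S B) :
    BoolPower S' B :=
  have key : ∀ φ : BoundedLatticeHom B Prop,
      ∃! s : S', φ (if hs : (s : D) ∈ S then ξ.toFun ⟨s, hs⟩ else ⊥) := by
    intro φ
    refine ⟨⟨ξ.val φ, h (ξ.val φ).2⟩, ?_, ?_⟩
    · dsimp only
      rw [dif_pos (ξ.val φ).2]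
      exact ξ.val_spec φ
    · rintro ⟨s, hs'⟩ hs
      dsimp only at hs
      split_ifs at hs with hS
      · have := (ξ.val_eq_iff φ _).2 hs
        exact Subtype.ext (congrArg Subtype.val this).symm
      · rw [map_bot] at hs
        exact hs.elim
  { toFun := fun s => if hs : (s : D) ∈ S then ξ.toFun ⟨s, hs⟩ else ⊥
    disjoint := (of_existsUnique key).1
    cover := (of_existsUnique key).2 }

theorem val_mapFun {B' : Type u} [BooleanAlgebra B'] (h : BoundedLatticeHom B B')
    (ξ : BoolPower S B) (φ : BoundedLatticeHom B' Prop) :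
    (mapFun h ξ).val φ = ξ.val (φ.comp h) :=
  ((mapFun h ξ).val_eq_iff φ _).2 (ξ.val_spec (φ.comp h))

open scoped Classical in
theorem coe_val_extFun {S' : Ω.Substructure D} (h : S ≤ S') (ξ : BoolPower S B)
    (φ : BoundedLatticeHom B Prop) : ((extFun h ξ).val φ : D) = ξ.val φ := by
  have h1 : (extFun h ξ).val φ = ⟨ξ.val φ, h (ξ.val φ).2⟩ := by
    rw [val_eq_iff]
    change φ (if hs : _ then _ else _)
    rw [dif_pos (ξ.val φ).2]
    exact ξ.val_spec φ
  rw [h1]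

theorem ext_coe_val {ξ ζ : BoolPower S B} (h : ∀ φ, (ξ.val φ : D) = ζ.val φ) : ξ = ζ :=
  ext_val fun φ => Subtype.ext (h φ)

end BoolPower

open CategoryTheory

variable [Ω.IsAlgebraic]

/-- The Boolean power as an object of the variety. -/
noncomputable def boolPower (S : Ω.Substructure D) (B : BoolAlg.{u}) : Var Ω D where
  carrier := BoolPower S B
  mem := BoolPower.inHSP S B

/-- The homomorphism `S[B] → S'[B']` induced by `S ≤ S'` and `B → B'`. -/
noncomputable def boolPowerHom {S S' : Ω.Substructure D} (h : S ≤ S') {B B' : BoolAlg.{u}}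
    (f : B ⟶ B') : BoolPower S B →[Ω] BoolPower S' B' :=
  homMk (fun ξ => BoolPower.extFun h (BoolPower.mapFun f.hom ξ))
    (by
      intro n g ξ
      refine BoolPower.ext_coe_val fun φ => ?_
      rw [BoolPower.coe_val_extFun, BoolPower.val_mapFun, BoolPower.val_funMap,
        BoolPower.val_funMap, coe_funMap, coe_funMap]
      refine congrArg (funMap g) (funext fun k => ?_)
      rw [BoolPower.coe_val_extFun, BoolPower.val_mapFun])

/-- The homomorphism `S[B] → S'[B']` as a morphism of the variety. -/
noncomputable def boolPowerMap {S S' : Ω.Substructure D} (h : S ≤ S') {B B' : BoolAlg.{u}}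
    (f : B ⟶ B') : boolPower S B ⟶ boolPower S' B' :=
  Var.ofHom (A := boolPower S B) (B := boolPower S' B') (boolPowerHom h f)

theorem boolPower_ext {A : Var Ω D} {S : Ω.Substructure D} {B : BoolAlg.{u}}
    {f g : A ⟶ boolPower S B}
    (h : ∀ a φ, ((show BoolPower S B from Var.hom f a).val φ : D) =
      (show BoolPower S B from Var.hom g a).val φ) : f = g :=
  Var.ext fun a => BoolPower.ext_coe_val (h a)

theorem coe_val_boolPowerMap {S S' : Ω.Substructure D} (h : S ≤ S') {B B' : BoolAlg.{u}}
    (f : B ⟶ B') (ξ : BoolPower S B) (φ : BoundedLatticeHom B' Prop) :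
    (((Var.hom (boolPowerMap h f) ξ : BoolPower S' B')).val φ : D) = ξ.val (φ.comp f.hom) := by
  refine (BoolPower.coe_val_extFun h _ φ).trans ?_
  rw [BoolPower.val_mapFun]

theorem boolPowerMap_id (S : Ω.Substructure D) (B : BoolAlg.{u}) :
    boolPowerMap (le_refl S) (𝟙 B) = 𝟙 _ :=
  boolPower_ext fun ξ φ => coe_val_boolPowerMap le_rfl (𝟙 B) ξ φ

theorem boolPowerMap_comp {S S' S'' : Ω.Substructure D} (h : S ≤ S') (h' : S' ≤ S'')
    {B B' B'' : BoolAlg.{u}} (f : B ⟶ B') (f' : B' ⟶ B'') :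
    boolPowerMap h f ≫ boolPowerMap h' f' = boolPowerMap (h.trans h') (f ≫ f') :=
  boolPower_ext fun ξ φ => by
    refine (coe_val_boolPowerMap h' f' _ φ).trans ?_
    refine (coe_val_boolPowerMap h f ξ _).trans ?_
    exact (coe_val_boolPowerMap (h.trans h') (f ≫ f') ξ φ).symm

variable (Ω D) in
/-- The Boolean power functors, covariant in the subalgebra. -/
noncomputable def boolPowerFunctor : Ω.Substructure D ⥤ BoolAlg.{u} ⥤ Var Ω D where
  obj S :=
    { obj := fun B => boolPower S B
      map := fun f => boolPowerMap le_rfl f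
      map_id := fun _ => boolPowerMap_id _ _
      map_comp := fun _ _ => (boolPowerMap_comp _ _ _ _).symm }
  map s :=
    { app := fun B => boolPowerMap (leOfHom s) (𝟙 B)
      naturality := fun _ _ _ => by
        dsimp only
        rw [boolPowerMap_comp, boolPowerMap_comp, Category.id_comp, Category.comp_id] }
  map_id S := NatTrans.ext (funext fun _ => boolPowerMap_id _ _)
  map_comp s t := NatTrans.ext (funext fun _ => by
    refine Eq.trans ?_ (boolPowerMap_comp _ _ _ _).symm
    rw [Category.comp_id])

end BoolPower

section SetD

open CategoryTheory CategoryTheory.Limits Opposite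

variable (Ω : FirstOrder.Language.{w, w'}) (D : Type u) [Ω.Structure D]

/-- Sets with a map to the subalgebras of `D`. -/
structure SetD where
  /-- The underlying set. -/
  carrier : Type u
  /-- The subalgebra assigned to a point. -/
  v : carrier → Ω.Substructure D

variable {Ω D}

/-- Morphisms of `SetD`. -/
@[ext]
structure SetD.Hom (X Y : SetD Ω D) where
  /-- The underlying map. -/
  toFun : X.carrier → Y.carrier
  v_le : ∀ x, Y.v (toFun x) ≤ X.v x

instance : Category (SetD Ω D) where
  Hom := SetD.Hom
  id _ := ⟨fun x => x, fun _ => le_rfl⟩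
  comp f g := ⟨fun x => g.toFun (f.toFun x), fun x => (g.v_le _).trans (f.v_le x)⟩

theorem SetD.hom_ext {X Y : SetD Ω D} {f g : X ⟶ Y} (h : ∀ x, f.toFun x = g.toFun x) : f = g :=
  SetD.Hom.ext (funext h)

@[simp] theorem SetD.id_toFun (X : SetD Ω D) (x : X.carrier) :
    SetD.Hom.toFun (𝟙 X) x = x := rfl

@[simp] theorem SetD.comp_toFun {X Y Z : SetD Ω D} (f : X ⟶ Y) (g : Y ⟶ Z) (x : X.carrier) :
    SetD.Hom.toFun (f ≫ g) x = g.toFun (f.toFun x) := rfl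

theorem SetD.congr_toFun {X Y : SetD Ω D} {f g : X ⟶ Y} (h : f = g) (x : X.carrier) :
    f.toFun x = g.toFun x := by rw [h]

variable (Ω D) in
/-- The functors `V^S`, contravariant in `S`. -/
def vFunctor : (Ω.Substructure D)ᵒᵖ ⥤ Type u ⥤ SetD Ω D where
  obj S :=
    { obj := fun X => ⟨X, fun _ => S.unop⟩
      map := fun f => ⟨fun x => f x, fun _ => le_rfl⟩
      map_id := fun _ => rfl
      map_comp := fun _ _ => rfl }
  map s :=
    { app := fun _ => ⟨fun x => x, fun _ => leOfHom s.unop⟩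
      naturality := fun _ _ _ => rfl }
  map_id _ := rfl
  map_comp _ _ := rfl

variable (Ω D) in
/-- The functors `C^S`, covariant in `S`. -/
def cFunctor : Ω.Substructure D ⥤ SetD Ω D ⥤ Type u where
  obj S :=
    { obj := fun X => {x : X.carrier // X.v x ≤ S}
      map := fun f => TypeCat.ofHom fun x => ⟨f.toFun x.1, (f.v_le x.1).trans x.2⟩
      map_id := fun _ => rfl
      map_comp := fun _ _ => rfl }
  map s :=
    { app := fun _ => TypeCat.ofHom fun x => ⟨x.1, x.2.trans (leOfHom s)⟩
      naturality := fun _ _ _ => rfl }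
  map_id _ := rfl
  map_comp _ _ := rfl

variable (Ω D) in
/-- The forgetful functor. -/
def forgetD : SetD Ω D ⥤ Type u where
  obj X := X.carrier
  map f := TypeCat.ofHom f.toFun
  map_id _ := rfl
  map_comp _ _ := rfl

instance : HasColimitsOfSize.{u, u} (SetD Ω D) where
  has_colimits_of_shape J _ :=
    { has_colimit := fun F => ⟨⟨
        { cocone :=
            { pt :=
                { carrier := colimit (F ⋙ forgetD Ω D)
                  v := fun z => sInf {S | ∃ (j : J) (y : (F.obj j).carrier),
                    colimit.ι (F ⋙ forgetD Ω D) j y = z ∧ (F.obj j).v y = S} }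
              ι :=
                { app := fun j => ⟨fun y => colimit.ι (F ⋙ forgetD Ω D) j y,
                    fun y => sInf_le ⟨j, y, rfl, rfl⟩⟩
                  naturality := fun i j f => SetD.hom_ext fun x =>
                    ConcreteCategory.congr_hom (colimit.w (F ⋙ forgetD Ω D) f) x } }
          isColimit :=
            { desc := fun s => ⟨fun z => colimit.desc (F ⋙ forgetD Ω D)
                  ((forgetD Ω D).mapCocone s) z, by
                intro z
                refine le_sInf ?_
                rintro _ ⟨j, y, rfl, rfl⟩
                have h := ConcreteCategory.congr_hom (colimit.ι_desc
                  ((forgetD Ω D).mapCocone s) j) y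
                exact (congrArg s.pt.v h).le.trans ((s.ι.app j).v_le y)⟩
              fac := fun s j => SetD.hom_ext fun y =>
                ConcreteCategory.congr_hom (colimit.ι_desc ((forgetD Ω D).mapCocone s) j) y
              uniq := fun s m hm => by
                have h : (forgetD Ω D).map m = colimit.desc (F ⋙ forgetD Ω D)
                    ((forgetD Ω D).mapCocone s) := by
                  refine colimit.hom_ext fun j => ?_
                  rw [colimit.ι_desc]
                  ext y
                  exact SetD.congr_toFun (hm j) y
                exact SetD.hom_ext fun z => ConcreteCategory.congr_hom h z } }⟩⟩ }

/-- The bifunctor `(S, S') ↦ V^S T C^S' (X, v)`, functorially in `(X, v)`. -/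
def coendDiagram (T : Type u ⥤ Type u) :
    SetD Ω D ⥤ (Ω.Substructure D)ᵒᵖ ⥤ Ω.Substructure D ⥤ SetD Ω D :=
  (cFunctor Ω D).flip ⋙
    (Functor.whiskeringRight (Ω.Substructure D) (Type u) ((Ω.Substructure D)ᵒᵖ ⥤ SetD Ω D)).obj
      (T ⋙ (vFunctor Ω D).flip) ⋙ flipFunctor _ _ _

variable (Ω D) in
/-- The lifting `T'(X, v) = ∫^S V^S T C^S (X, v)` of a functor `T : Set → Set`. -/
noncomputable def liftSet (T : Type u ⥤ Type u) : SetD Ω D ⥤ SetD Ω D :=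
  coendDiagram T ⋙ coendFunctor (Ω.Substructure D) (SetD Ω D)

/-- The coend morphism `V^S T C^S (X, v) → T'(X, v)`. -/
noncomputable def liftSetι (T : Type u ⥤ Type u) (X : SetD Ω D) (S : Ω.Substructure D) :
    ((vFunctor Ω D).obj (op S)).obj (T.obj (((cFunctor Ω D).obj S).obj X)) ⟶
      (liftSet Ω D T).obj X :=
  coend.ι ((coendDiagram T).obj X) S

theorem liftSetι_naturality (T : Type u ⥤ Type u) {X Y : SetD Ω D} (f : X ⟶ Y)
    (S : Ω.Substructure D) :
    liftSetι T X S ≫ (liftSet Ω D T).map f =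
      ((vFunctor Ω D).obj (op S)).map (T.map (((cFunctor Ω D).obj S).map f)) ≫ liftSetι T Y S :=
  coend.ι_map _ S

variable [Ω.IsAlgebraic]

/-- The algebra `P'(X, v) = ∏ₓ v(x)`. -/
def prodObj (X : SetD Ω D) : Var Ω D where
  carrier := ∀ x, X.v x
  mem := InHSP.of_injective (A := ∀ _ : X.carrier, D) (InHSP.pi fun _ => InHSP.self)
    (homMk (fun α x => (α x : D)) fun _ _ _ => rfl)
    fun _ _ h => funext fun x => Subtype.ext (congrFun h x)

/-- Precomposition with a morphism. -/
def prodMap {X Y : SetD Ω D} (f : X ⟶ Y) : prodObj Y ⟶ prodObj X :=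
  Var.ofHom (A := prodObj Y) (B := prodObj X)
    (homMk (A := ∀ y, Y.v y) (B := ∀ x, X.v x)
      (fun α x => ⟨α (f.toFun x), f.v_le x (α (f.toFun x)).2⟩) fun _ _ _ => rfl)

theorem prodObj_ext {A : Var Ω D} {X : SetD Ω D} {f g : A ⟶ prodObj X}
    (h : ∀ (a : A) (x : X.carrier), ((Var.hom f a : ∀ x, X.v x) x : D) =
      (Var.hom g a : ∀ x, X.v x) x) : f = g :=
  Var.ext fun a => funext fun x => Subtype.ext (h a x)

theorem prodMap_comp {X Y Z : SetD Ω D} (f : X ⟶ Y) (g : Y ⟶ Z) :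
    prodMap (f ≫ g) = prodMap g ≫ prodMap f := prodObj_ext fun _ _ => rfl

variable (Ω D) in
/-- The functor `P'`. -/
def prodFunctor : (SetD Ω D)ᵒᵖ ⥤ Var Ω D where
  obj X := prodObj X.unop
  map f := prodMap f.unop
  map_id _ := prodObj_ext fun _ _ => rfl
  map_comp _ _ := prodObj_ext fun _ _ => rfl

/-- The object `S'(A)`: the homomorphisms `A → D`, each with its image. -/
def homObj (A : Var Ω D) : SetD Ω D where
  carrier := A →[Ω] D
  v u := u.range

/-- A point of `S'(A)` as a homomorphism. -/
def homObj.hom {A : Var Ω D} (u : (homObj A).carrier) : A →[Ω] D := u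

/-- The transpose of a homomorphism `A → P'(X, v)` under the dual adjunction `S' ⊣ P'`. -/
def transpose {A : Var Ω D} {X : SetD Ω D} (f : A ⟶ prodObj X) : X ⟶ homObj A where
  toFun x := homMk (fun a => ((Var.hom f a : ∀ x, X.v x) x : D)) fun n g y => by
    rw [(Var.hom f).map_fun]
    rfl
  v_le x := by
    rintro _ ⟨a, rfl⟩
    exact ((Var.hom f a : ∀ x, X.v x) x).2

/-- The transpose of a morphism `(X, v) → S'(A)` under the dual adjunction `S' ⊣ P'`. -/
def untranspose {A : Var Ω D} {X : SetD Ω D} (g : X ⟶ homObj A) : A ⟶ prodObj X :=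
  Var.ofHom (A := A) (B := prodObj X) (homMk (A := A) (B := ∀ x, X.v x)
    (fun a x => ⟨homObj.hom (g.toFun x) a, g.v_le x ⟨a, rfl⟩⟩)
    fun _ h y => funext fun x => Subtype.ext ((homObj.hom (g.toFun x)).map_fun h y))

theorem transpose_naturality {A : Var Ω D} {X Y : SetD Ω D} (h : X ⟶ Y) (f : A ⟶ prodObj Y) :
    h ≫ transpose f = transpose (f ≫ prodMap h) := rfl

/-- The universal property of `P'(∫^j G(j, j)) = ∫_j P'(G(j, j))`: a wedge `A → P'(G(j, j))`
factors through `P'(∫^j G(j, j))`. -/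
noncomputable def prodCoendLift {J : Type u} [SmallCategory J] {G : Jᵒᵖ ⥤ J ⥤ SetD Ω D}
    {A : Var Ω D} (f : ∀ j, A ⟶ prodObj ((G.obj (op j)).obj j))
    (hf : ∀ ⦃i j : J⦄ (g : i ⟶ j),
      f i ≫ prodMap ((G.map g.op).app i) = f j ≫ prodMap ((G.obj (op j)).map g)) :
    A ⟶ prodObj (coend G) :=
  untranspose (coend.desc (fun j => transpose (f j)) fun i j g => by
    rw [transpose_naturality, transpose_naturality, hf])

theorem prodCoendLift_fac {J : Type u} [SmallCategory J] {G : Jᵒᵖ ⥤ J ⥤ SetD Ω D}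
    {A : Var Ω D} (f : ∀ j, A ⟶ prodObj ((G.obj (op j)).obj j))
    (hf : ∀ ⦃i j : J⦄ (g : i ⟶ j),
      f i ≫ prodMap ((G.map g.op).app i) = f j ≫ prodMap ((G.obj (op j)).map g)) (j : J) :
    prodCoendLift f hf ≫ prodMap (coend.ι G j) = f j :=
  prodObj_ext fun a x => by
    have h := SetD.congr_toFun (coend.ι_desc (F := G) (fun j => transpose (f j)) (fun i j g => by
      rw [transpose_naturality, transpose_naturality, hf]) j) x
    exact DFunLike.congr_fun (F := A →[Ω] D) h a

theorem prodCoend_ext {J : Type u} [SmallCategory J] {G : Jᵒᵖ ⥤ J ⥤ SetD Ω D}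
    {A : Var Ω D} {f g : A ⟶ prodObj (coend G)}
    (h : ∀ j, f ≫ prodMap (coend.ι G j) = g ≫ prodMap (coend.ι G j)) : f = g := by
  have h' : transpose f = transpose g := coend.hom_ext fun j => by
    rw [transpose_naturality, transpose_naturality, h]
  refine prodObj_ext fun a x => ?_
  exact DFunLike.congr_fun (F := A →[Ω] D) (SetD.congr_toFun h' x) a

end SetD

section Lifting

open CategoryTheory CategoryTheory.Limits Opposite

/-- An abstract coalgebraic logic for `T`, with respect to the predicate functor `P` of a dual
adjunction `S ⊣ P`: an endofunctor `L` and a natural transformation `δ : LP ⇒ PT`. The adjoint `S`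
is determined by `P` up to isomorphism and is not part of the data. -/
structure CoalgebraicLogic {C : Type*} [Category* C] {V : Type*} [Category* V] (P : Cᵒᵖ ⥤ V)
    (T : C ⥤ C) where
  /-- The endofunctor on the algebraic side. -/
  L : V ⥤ V
  /-- The one-step semantics. -/
  δ : P ⋙ L ⟶ T.op ⋙ P

/-- One-step completeness: `δ` is a componentwise monomorphism. -/
def CoalgebraicLogic.IsOneStepComplete {C : Type*} [Category* C] {V : Type*} [Category* V]
    {P : Cᵒᵖ ⥤ V} {T : C ⥤ C} (ℓ : CoalgebraicLogic P T) : Prop :=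
  ∀ X, Mono (ℓ.δ.app X)

/-- The contravariant powerset functor into Boolean algebras; the coalgebraic logics with respect
to it are the classical ones. -/
def powersetFunctor : (Type u)ᵒᵖ ⥤ BoolAlg.{u} := typeToBoolAlgOp.leftOp

variable (Ω : FirstOrder.Language.{w, w'}) [Ω.IsAlgebraic] (D : Type u) [Ω.Structure D]
  [Finite D] [Lattice D] [BoundedOrder D] [IsSemiPrimal Ω D] [HasBoundedLatticeReduct Ω D]

/-- The functors `K_S`, contravariant in `S`: the Boolean skeleton of the quotient by
`theta S A`. -/
noncomputable def kFunctor : (Ω.Substructure D)ᵒᵖ ⥤ Var Ω D ⥤ BoolAlg.{u} :=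
  quotFunctor Ω D ⋙ (Functor.whiskeringRight _ _ _).obj (skeleton Ω D)

variable {Ω D}

/-- The bifunctor `(S, S') ↦ 𝔓_S' L K_S (A)`, functorially in `A`. -/
noncomputable def endDiagram (L : BoolAlg.{u} ⥤ BoolAlg.{u}) :
    Var Ω D ⥤ (Ω.Substructure D)ᵒᵖ ⥤ Ω.Substructure D ⥤ Var Ω D :=
  (kFunctor Ω D).flip ⋙
    (Functor.whiskeringRight (Ω.Substructure D)ᵒᵖ BoolAlg.{u} (Ω.Substructure D ⥤ Var Ω D)).obj
      (L ⋙ (boolPowerFunctor Ω D).flip)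

variable (Ω D) in
/-- The lifting `L'(A) = ∫_S 𝔓_S L K_S (A)` of a functor `L : BA → BA`. -/
noncomputable def liftAlg (L : BoolAlg.{u} ⥤ BoolAlg.{u}) : Var Ω D ⥤ Var Ω D :=
  endDiagram L ⋙ endFunctor (Ω.Substructure D) (Var Ω D)

/-- The end morphism `L'(A) → 𝔓_S L K_S (A)`. -/
noncomputable def liftAlgπ (L : BoolAlg.{u} ⥤ BoolAlg.{u}) (A : Var Ω D) (S : Ω.Substructure D) :
    (liftAlg Ω D L).obj A ⟶
      ((boolPowerFunctor Ω D).obj S).obj (L.obj (((kFunctor Ω D).obj (op S)).obj A)) :=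
  end_.π ((endDiagram L).obj A) S

theorem liftAlgπ_condition (L : BoolAlg.{u} ⥤ BoolAlg.{u}) (A : Var Ω D)
    {S S' : Ω.Substructure D} (s : S ⟶ S') :
    liftAlgπ L A S ≫
        ((boolPowerFunctor Ω D).map s).app (L.obj (((kFunctor Ω D).obj (op S)).obj A)) =
      liftAlgπ L A S' ≫
        ((boolPowerFunctor Ω D).obj S').map (L.map (((kFunctor Ω D).map s.op).app A)) :=
  end_.condition ((endDiagram L).obj A) s

theorem liftAlgπ_naturality (L : BoolAlg.{u} ⥤ BoolAlg.{u}) {A B : Var Ω D} (f : A ⟶ B)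
    (S : Ω.Substructure D) :
    (liftAlg Ω D L).map f ≫ liftAlgπ L B S =
      liftAlgπ L A S ≫
        ((boolPowerFunctor Ω D).obj S).map (L.map (((kFunctor Ω D).obj (op S)).map f)) :=
  end_.map_π _ S

/-- For `v(x) ≤ S`, the evaluation `P'(X, v) → D` at `x` factors through the quotient by
`theta S`. -/
def evalQuotient (S : Ω.Substructure D) (X : SetD Ω D) (x : X.carrier) (hx : X.v x ≤ S) :
    Quotient (theta S (prodObj X)) →[Ω] D :=
  homMk
    (Quotient.lift (fun α : ∀ x, X.v x => (α x : D)) fun α β h =>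
      h (homMk (A := ∀ x, X.v x) (fun α => (α x : D)) fun _ _ _ => rfl) fun α => hx (α x).2)
    (by
      intro n g y
      obtain ⟨z, rfl⟩ : ∃ z : Fin n → (prodObj X), y = fun k => Quotient.mk _ (z k) :=
        ⟨fun k => (y k).out, funext fun k => (Quotient.out_eq (y k)).symm⟩
      rw [funMap_quotient_mk' (theta S (prodObj X)) g z]
      rfl)

/-- The evaluation at `x` on the quotient, as an object of the variety. -/
def evalQuot (S : Ω.Substructure D) (X : SetD Ω D) (x : X.carrier) (hx : X.v x ≤ S) :
    quot S (prodObj X) →[Ω] D :=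
  evalQuotient S X x hx

theorem evalQuot_skel (S : Ω.Substructure D) (X : SetD Ω D) (x : X.carrier) (hx : X.v x ≤ S)
    (a : Skel (quot S (prodObj X))) :
    evalQuot S X x hx a.val = ⊤ ∨ evalQuot S X x hx a.val = ⊥ := by
  have h := congrArg (evalQuot S X x hx) a.prop
  rw [map_charOp, charOp_self, charFun] at h
  split_ifs at h with h'
  exacts [Or.inl h', Or.inr h.symm]

/-- The inverse of the natural isomorphism `P C^S ⇒ K_S P'`: the class of `α` is sent to the set
of all `x` in `C^S (X, v)` with `α(x) = 1`. -/
noncomputable def psiInv [Nontrivial D] (S : Ω.Substructure D) (X : SetD Ω D) :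
    ((kFunctor Ω D).obj (op S)).obj (prodObj X) ⟶
      powersetFunctor.obj (op (((cFunctor Ω D).obj S).obj X)) :=
  BoolAlg.ofHom (X := Skel (quot S (prodObj X))) (Y := Set {x : X.carrier // X.v x ≤ S})
    { toFun := fun a => {x | evalQuot S X x.1 x.2 a.val = ⊤}
      map_sup' := fun a b => by
        ext x
        change evalQuot S X x.1 x.2 (supOp Ω D a.val b.val) = ⊤ ↔ (_ ∨ _)
        rw [map_supOp, supOp_self]
        change _ ↔ (evalQuot S X x.1 x.2 a.val = ⊤ ∨ evalQuot S X x.1 x.2 b.val = ⊤)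
        rcases evalQuot_skel S X x.1 x.2 a with h | h <;>
          rcases evalQuot_skel S X x.1 x.2 b with h' | h' <;> simp [h, h']
      map_inf' := fun a b => by
        ext x
        change evalQuot S X x.1 x.2 (infOp Ω D a.val b.val) = ⊤ ↔ (_ ∧ _)
        rw [map_infOp, infOp_self]
        exact inf_eq_top_iff
      map_top' := by
        ext x
        change evalQuot S X x.1 x.2 (topOp Ω D _) = ⊤ ↔ True
        rw [map_topOp, topOp_self]
        simp
      map_bot' := by
        ext x
        change evalQuot S X x.1 x.2 (botOp Ω D _) = ⊤ ↔ False
        rw [map_botOp, botOp_self]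
        simp }

theorem psiInv_naturality [Nontrivial D] (S : Ω.Substructure D) {X Y : SetD Ω D} (f : X ⟶ Y) :
    ((kFunctor Ω D).obj (op S)).map (prodMap f) ≫ psiInv S X =
      psiInv S Y ≫ powersetFunctor.map (((cFunctor Ω D).obj S).map f).op :=
  BoolAlg.ext fun a => by
    obtain ⟨a, ha⟩ := a
    induction a using Quotient.inductionOn with
    | h α => rfl

theorem psiInv_dinaturality [Nontrivial D] {S S' : Ω.Substructure D} (s : S ⟶ S')
    (X : SetD Ω D) :
    ((kFunctor Ω D).map s.op).app (prodObj X) ≫ psiInv S X =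
      psiInv S' X ≫ powersetFunctor.map (((cFunctor Ω D).map s).app X).op :=
  BoolAlg.ext fun a => by
    obtain ⟨a, ha⟩ := a
    induction a using Quotient.inductionOn with
    | h α => rfl

/-- The point of a powerset algebra given by `x`. -/
def pointOf {X : Type u} (x : X) : BoundedLatticeHom (Set X) Prop where
  toFun Y := x ∈ Y
  map_sup' _ _ := rfl
  map_inf' _ _ := rfl
  map_top' := rfl
  map_bot' := rfl

/-- The inverse of the natural isomorphism `P' V^S ⇒ 𝔓_S P`: it sends `ξ : S → 2^X` to the map
taking `x` to the unique `s` with `x ∈ ξ(s)`. -/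
noncomputable def thetaInv (S : Ω.Substructure D) (X : Type u) :
    ((boolPowerFunctor Ω D).obj S).obj (powersetFunctor.obj (op X)) ⟶
      prodObj (((vFunctor Ω D).obj (op S)).obj X) :=
  Var.ofHom (A := boolPower S (BoolAlg.of (Set X)))
    (B := prodObj (((vFunctor Ω D).obj (op S)).obj X))
    (homMk (A := BoolPower S (Set X)) (B := ∀ _ : X, S)
      (fun ξ x => ξ.val (pointOf x)) fun _ g ξ => funext fun x =>
        BoolPower.val_funMap g ξ (pointOf x))

theorem mem_iff_thetaInv (S : Ω.Substructure D) (X : Type u) (ξ : BoolPower S (Set X)) (x : X)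
    (s : S) : x ∈ ξ.toFun s ↔ (Var.hom (thetaInv S X) ξ : ∀ _ : X, S) x = s :=
  (ξ.val_eq_iff (pointOf x) s).symm

theorem thetaInv_naturality (S : Ω.Substructure D) {X Y : Type u} (f : X ⟶ Y) :
    ((boolPowerFunctor Ω D).obj S).map (powersetFunctor.map f.op) ≫ thetaInv S X =
      thetaInv S Y ≫ prodMap (((vFunctor Ω D).obj (op S)).map f) :=
  prodObj_ext fun ξ x => coe_val_boolPowerMap (le_refl S) (powersetFunctor.map f.op) ξ (pointOf x)

theorem thetaInv_dinaturality {S S' : Ω.Substructure D} (s : S ⟶ S') (X : Type u) :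
    ((boolPowerFunctor Ω D).map s).app (powersetFunctor.obj (op X)) ≫ thetaInv S' X =
      thetaInv S X ≫ prodMap (((vFunctor Ω D).map s.op).app X) :=
  prodObj_ext fun ξ x => coe_val_boolPowerMap (leOfHom s) (𝟙 _) ξ (pointOf x)

variable [Nontrivial D] {T : Type u ⥤ Type u}

/-- The arrows
`L'P'(X, v) → 𝔓_S L K_S P'(X, v) ≅ 𝔓_S L P C^S (X, v) → 𝔓_S P T C^S (X, v) ≅ P' V^S T C^S (X, v)`
defining the lifting of `δ`. -/
noncomputable def wedge (ℓ : CoalgebraicLogic powersetFunctor.{u} T) (X : SetD Ω D)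
    (S : Ω.Substructure D) :
    (liftAlg Ω D ℓ.L).obj (prodObj X) ⟶
      prodObj (((vFunctor Ω D).obj (op S)).obj (T.obj (((cFunctor Ω D).obj S).obj X))) :=
  liftAlgπ ℓ.L (prodObj X) S ≫
    ((boolPowerFunctor Ω D).obj S).map (ℓ.L.map (psiInv S X)) ≫
    ((boolPowerFunctor Ω D).obj S).map (ℓ.δ.app (op (((cFunctor Ω D).obj S).obj X))) ≫
    thetaInv S _

theorem wedge_condition (ℓ : CoalgebraicLogic powersetFunctor.{u} T) (X : SetD Ω D)
    {S S' : Ω.Substructure D} (s : S ⟶ S') :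
    wedge ℓ X S ≫ prodMap ((((coendDiagram T).obj X).map s.op).app S) =
      wedge ℓ X S' ≫ prodMap ((((coendDiagram T).obj X).obj (op S')).map s) := by
  have hE := liftAlgπ_condition ℓ.L (prodObj X) s
  have hδ : ℓ.L.map (powersetFunctor.map (((cFunctor Ω D).map s).app X).op) ≫
        ℓ.δ.app (op (((cFunctor Ω D).obj S).obj X)) =
      ℓ.δ.app (op (((cFunctor Ω D).obj S').obj X)) ≫
        powersetFunctor.map (T.map (((cFunctor Ω D).map s).app X)).op :=
    ℓ.δ.naturality (((cFunctor Ω D).map s).app X).op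
  have hΨ := psiInv_dinaturality s X
  have hΘ := thetaInv_dinaturality s (T.obj (((cFunctor Ω D).obj S).obj X))
  have hΘ' := thetaInv_naturality S' (T.map (((cFunctor Ω D).map s).app X))
  have hL := congrArg ℓ.L.map hΨ
  rw [Functor.map_comp, Functor.map_comp] at hL
  have hδ' := congrArg ((boolPowerFunctor Ω D).obj S').map hδ
  have hL' := congrArg ((boolPowerFunctor Ω D).obj S').map hL
  rw [Functor.map_comp, Functor.map_comp] at hδ' hL'
  have hn := fun {B B' : BoolAlg.{u}} (g : B ⟶ B') =>
    ((boolPowerFunctor Ω D).map s).naturality g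
  unfold wedge
  change (_ ≫ _ ≫ _ ≫ _) ≫ prodMap (((vFunctor Ω D).map s.op).app
      (T.obj (((cFunctor Ω D).obj S).obj X))) = (_ ≫ _ ≫ _ ≫ _) ≫
    prodMap (((vFunctor Ω D).obj (op S')).map (T.map (((cFunctor Ω D).map s).app X)))
  simp only [Category.assoc]
  rw [← hΘ, ← hΘ', reassoc_of% hn, reassoc_of% hn, reassoc_of% hE, reassoc_of% hL',
    reassoc_of% hδ']

theorem wedge_naturality (ℓ : CoalgebraicLogic powersetFunctor.{u} T) {X Y : SetD Ω D}
    (f : X ⟶ Y) (S : Ω.Substructure D) :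
    (liftAlg Ω D ℓ.L).map (prodMap f) ≫ wedge ℓ X S =
      wedge ℓ Y S ≫ prodMap (((vFunctor Ω D).obj (op S)).map
        (T.map (((cFunctor Ω D).obj S).map f))) := by
  have hE := liftAlgπ_naturality ℓ.L (prodMap f) S
  have hδ : ℓ.L.map (powersetFunctor.map (((cFunctor Ω D).obj S).map f).op) ≫
        ℓ.δ.app (op (((cFunctor Ω D).obj S).obj X)) =
      ℓ.δ.app (op (((cFunctor Ω D).obj S).obj Y)) ≫
        powersetFunctor.map (T.map (((cFunctor Ω D).obj S).map f)).op :=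
    ℓ.δ.naturality (((cFunctor Ω D).obj S).map f).op
  have hΘ := thetaInv_naturality S (T.map (((cFunctor Ω D).obj S).map f))
  have hL := congrArg ℓ.L.map (psiInv_naturality S f)
  rw [Functor.map_comp, Functor.map_comp] at hL
  have hδ' := congrArg ((boolPowerFunctor Ω D).obj S).map hδ
  have hL' := congrArg ((boolPowerFunctor Ω D).obj S).map hL
  rw [Functor.map_comp, Functor.map_comp] at hδ' hL'
  unfold wedge
  simp only [Category.assoc]
  rw [← hΘ, reassoc_of% hE, reassoc_of% hL', reassoc_of% hδ']

/-- The component of the lifting of `δ` at `(X, v)`: the factorization of the wedge through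
`P'T'(X, v) = P'(∫^S V^S T C^S (X, v))`. -/
noncomputable def liftDeltaApp (ℓ : CoalgebraicLogic powersetFunctor.{u} T) (X : SetD Ω D) :
    (liftAlg Ω D ℓ.L).obj (prodObj X) ⟶ prodObj ((liftSet Ω D T).obj X) :=
  prodCoendLift (G := (coendDiagram T).obj X) (fun S => wedge ℓ X S)
    fun _ _ s => wedge_condition ℓ X s

theorem liftDeltaApp_fac (ℓ : CoalgebraicLogic powersetFunctor.{u} T) (X : SetD Ω D)
    (S : Ω.Substructure D) :
    liftDeltaApp ℓ X ≫ prodMap (liftSetι T X S) = wedge ℓ X S :=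
  prodCoendLift_fac (G := (coendDiagram T).obj X) (fun S => wedge ℓ X S)
    (fun _ _ s => wedge_condition ℓ X s) S

/-- The lifting of `δ` to a natural transformation `L'P' ⇒ P'T'`. -/
noncomputable def liftDelta (ℓ : CoalgebraicLogic powersetFunctor.{u} T) :
    prodFunctor Ω D ⋙ liftAlg Ω D ℓ.L ⟶ (liftSet Ω D T).op ⋙ prodFunctor Ω D where
  app X := liftDeltaApp ℓ X.unop
  naturality Y X f := by
    refine prodCoend_ext fun S => ?_
    change ((liftAlg Ω D ℓ.L).map (prodMap f.unop) ≫ liftDeltaApp ℓ X.unop) ≫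
        prodMap (liftSetι T X.unop S) =
      (liftDeltaApp ℓ Y.unop ≫ prodMap ((liftSet Ω D T).map f.unop)) ≫
        prodMap (liftSetι T X.unop S)
    rw [Category.assoc, Category.assoc, liftDeltaApp_fac, ← prodMap_comp, liftSetι_naturality,
      prodMap_comp, wedge_naturality, reassoc_of% liftDeltaApp_fac ℓ Y.unop S]

variable (Ω D) in
/-- The lifting of a classical abstract coalgebraic logic. -/
noncomputable def CoalgebraicLogic.lift (ℓ : CoalgebraicLogic powersetFunctor.{u} T) :
    CoalgebraicLogic (prodFunctor Ω D) (liftSet Ω D T) where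
  L := liftAlg Ω D ℓ.L
  δ := liftDelta ℓ

end Lifting

end SemiPrimal

open CategoryTheory

/-!
The Boolean skeleton turns every construction in the lifted logic back into its classical
counterpart, and `δ'` is by definition a cone of Boolean powers of components of `δ`.

*Skeletons.* An element of the skeleton of a subalgebra of a power of `D` takes only the values `0`
and `1`, so it is determined by the set on which it is `1`; in `P'(X, v)` and in `S[B]` every such
set occurs, because every subalgebra of `D` contains `0` and `1`. Hence `𝔖P'(X, v) ≅ P(X)`
(`skelProd`) and `𝔖(S[B]) ≅ B` (`skelBoolPower`), and the isomorphism `𝔓_S P ≅ P' V^S` becomes the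
identity.

*The isomorphism `K_S P' ≅ P C^S`* (`psiInv_isIso`). A homomorphism `u : P'(X, v) → D` determines
the filter of all sets whose characteristic function is sent to `1`, and `u(α) = d` forces
`{x | α(x) = d}` into the filter, because `u` commutes with `T_d`. If `u` has image in `S`, then
`C^S (X, v)` is in the filter: otherwise `u` would take a value outside `S`. So `u(α)` depends only
on the restriction of `α` to `C^S (X, v)`, that is, `theta S` identifies exactly the elements with
the same restriction.

*One-step completeness.* The composite of `δ'` with the coend morphism at `S` is the end morphism
at `S` followed by isomorphisms, by `𝔓_S δ`, and by the injective `𝔓_S P → P' V^S`. Boolean powers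
preserve injectivity, and the end morphisms are jointly monic, so `δ'` is mono if `δ` is
(`mono_liftDeltaApp`).

*The skeleton of `δ'`.* The subalgebras of `D` have the greatest element `D`. The underlying set of
the coend `T'(X, v)` is the colimit of the sets `T(C^S (X, v))`, hence it is `T(C^D (X, v)) = T(X)`
(`liftSetι_top_bijective`). Dually, `𝔖L'(A)` is the limit of the algebras `L K_S (A)`, hence it is
`L K_D (A)` (`skelLiftAlg`). Under these identifications, `𝔖δ'` is given by its component at `D`,
which is `δ` (`skeleton_map_liftDeltaApp`).
-/

namespace SemiPrimal

open FirstOrder FirstOrder.Language FirstOrder.Language.Structure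
open CategoryTheory.Limits Opposite

/-! ### Monomorphisms and isomorphisms of Boolean algebras -/

/-- The kernel pair of a homomorphism, as a subalgebra of the square, tests for injectivity. -/
theorem boolAlg_injective_of_mono {A B : BoolAlg.{u}} (f : A ⟶ B) [Mono f] :
    Function.Injective f := by
  intro a b hab
  let K : BooleanSubalgebra (A × A) :=
    { carrier := {p | f p.1 = f p.2}
      supClosed' := fun p hp q hq => by
        change f (p.1 ⊔ q.1) = f (p.2 ⊔ q.2)
        rw [map_sup, map_sup, show f p.1 = f p.2 from hp, show f q.1 = f q.2 from hq]
      infClosed' := fun p hp q hq => by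
        change f (p.1 ⊓ q.1) = f (p.2 ⊓ q.2)
        rw [map_inf, map_inf, show f p.1 = f p.2 from hp, show f q.1 = f q.2 from hq]
      compl_mem' := fun {p} hp => by
        change f p.1ᶜ = f p.2ᶜ
        rw [map_compl', map_compl', show f p.1 = f p.2 from hp]
      bot_mem' := rfl }
  let p₁ : BoolAlg.of K ⟶ A := BoolAlg.ofHom (X := K) (Y := A)
    { toFun := fun p => p.1.1
      map_sup' := fun _ _ => rfl
      map_inf' := fun _ _ => rfl
      map_top' := rfl
      map_bot' := rfl }
  let p₂ : BoolAlg.of K ⟶ A := BoolAlg.ofHom (X := K) (Y := A)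
    { toFun := fun p => p.1.2
      map_sup' := fun _ _ => rfl
      map_inf' := fun _ _ => rfl
      map_top' := rfl
      map_bot' := rfl }
  have h : p₁ = p₂ := by
    rw [← cancel_mono f]
    exact BoolAlg.ext fun p => p.2
  exact ConcreteCategory.congr_hom h (⟨(a, b), hab⟩ : K)

theorem boolAlg_isIso_of_bijective {A B : BoolAlg.{u}} (f : A ⟶ B) (hf : Function.Bijective f) :
    IsIso f := by
  let e : A ≃o B :=
    { Equiv.ofBijective f hf with
      map_rel_iff' := fun {a b} => by
        change f a ≤ f b ↔ a ≤ b
        rw [← sup_eq_right, ← map_sup, hf.1.eq_iff, sup_eq_right] }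
  exact (BoolAlg.Iso.mk e).isIso_hom

section Evaluations

variable {Ω : FirstOrder.Language.{w, w'}} [Ω.IsAlgebraic] {D : Type u} [Ω.Structure D]

theorem mono_of_injective {A B : Var Ω D} (f : A ⟶ B) (hf : Function.Injective (Var.hom f)) :
    Mono f :=
  ⟨fun _ _ h => Var.ext fun a => hf (Var.congr_hom h a)⟩

/-- The evaluation of `P'(X, v)` at a point of `X`. -/
def evalHom (X : SetD Ω D) (x : X.carrier) : prodObj X →[Ω] D :=
  homMk (A := ∀ x, X.v x) (fun α => (α x : D)) fun _ _ _ => rfl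

theorem evalHom_ext {X : SetD Ω D} {α β : prodObj X}
    (h : ∀ x, evalHom X x α = evalHom X x β) : α = β :=
  funext fun x => Subtype.ext (h x)

/-- The evaluation of a Boolean power at a point of the Boolean algebra. -/
noncomputable def valHom [Finite D] (S : Ω.Substructure D) (B : BoolAlg.{u})
    (φ : BoundedLatticeHom B Prop) : boolPower S B →[Ω] D :=
  homMk (A := BoolPower S B) (fun ξ => (ξ.val φ : D)) fun _ g ξ =>
    congrArg Subtype.val (BoolPower.val_funMap g ξ φ)

end Evaluations

/-! ### Boolean skeletons of products and of Boolean powers -/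

section Skeletons

variable {Ω : FirstOrder.Language.{w, w'}} [Ω.IsAlgebraic] {D : Type u} [Ω.Structure D]
  [Lattice D] [BoundedOrder D] [IsSemiPrimal Ω D] [HasBoundedLatticeReduct Ω D]

/-- The top element `1` of a subalgebra. -/
def topElt (S : Ω.Substructure D) : S := ⟨⊤, top_mem Ω D S⟩

/-- The bottom element `0` of a subalgebra. -/
def botElt (S : Ω.Substructure D) : S := ⟨⊥, bot_mem Ω D S⟩

omit [Ω.IsAlgebraic] in
theorem topElt_ne_botElt [Nontrivial D] (S : Ω.Substructure D) : topElt S ≠ botElt S :=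
  fun h => top_ne_bot (congrArg Subtype.val h)

theorem charFun_eq_top_iff [Nontrivial D] {d x : D} : charFun D d x = ⊤ ↔ x = d := by
  unfold charFun
  split_ifs with h <;> simp [h]

omit [Ω.IsAlgebraic] in
/-- A homomorphism into `D` sends the Boolean skeleton to `{0, 1}`. -/
theorem Skel.map_eq_top_or_bot {A : Var Ω D} (u : A →[Ω] D) (a : Skel A) :
    u a.val = ⊤ ∨ u a.val = ⊥ := by
  have h := congrArg u a.prop
  rw [map_charOp, charOp_self, charFun] at h
  split_ifs at h with h'
  exacts [Or.inl h', Or.inr h.symm]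

/-- The point of the Boolean skeleton `𝔖(A)` given by a homomorphism `A → D`. -/
def Skel.point [Nontrivial D] {A : Var Ω D} (u : A →[Ω] D) : BoundedLatticeHom (Skel A) Prop where
  toFun a := u a.val = ⊤
  map_sup' a b := by
    rw [Skel.coe_sup, map_supOp, supOp_self]
    rcases Skel.map_eq_top_or_bot u a with h | h <;>
      rcases Skel.map_eq_top_or_bot u b with h' | h' <;> simp [h, h']
  map_inf' a b := by
    rw [Skel.coe_inf, map_infOp, infOp_self]
    exact propext inf_eq_top_iff
  map_top' := by
    rw [Skel.coe_top, map_topOp, topOp_self]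
    simp
  map_bot' := by
    rw [Skel.coe_bot, map_botOp, botOp_self]
    simp

theorem Skel.map_eq_of_point [Nontrivial D] {A B : Var Ω D} {u : A →[Ω] D} {u' : B →[Ω] D}
    {a : Skel A} {b : Skel B} (h : Skel.point u a ↔ Skel.point u' b) : u a.val = u' b.val := by
  change u a.val = ⊤ ↔ u' b.val = ⊤ at h
  rcases Skel.map_eq_top_or_bot u a with h1 | h1 <;>
    rcases Skel.map_eq_top_or_bot u' b with h2 | h2 <;> simp_all

open scoped Classical in
/-- The characteristic function of a set of points, as an element of `P'(X, v)`. -/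
noncomputable def indicator (X : SetD Ω D) (Y : Set X.carrier) : prodObj X :=
  show ∀ x, X.v x from fun x => if x ∈ Y then topElt _ else botElt _

theorem evalHom_indicator_of_mem {X : SetD Ω D} {Y : Set X.carrier} {x : X.carrier} (h : x ∈ Y) :
    evalHom X x (indicator X Y) = ⊤ :=
  congrArg Subtype.val (if_pos h)

theorem evalHom_indicator_of_notMem {X : SetD Ω D} {Y : Set X.carrier} {x : X.carrier}
    (h : x ∉ Y) : evalHom X x (indicator X Y) = ⊥ :=
  congrArg Subtype.val (if_neg h)

theorem evalHom_indicator_eq_top [Nontrivial D] {X : SetD Ω D} {Y : Set X.carrier}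
    {x : X.carrier} : evalHom X x (indicator X Y) = ⊤ ↔ x ∈ Y := by
  by_cases h : x ∈ Y
  · simp [evalHom_indicator_of_mem h, h]
  · simp [evalHom_indicator_of_notMem h, h]

theorem charOp_eq_indicator (X : SetD Ω D) (d : D) (α : prodObj X) :
    charOp Ω D d α = indicator X {x | evalHom X x α = d} := by
  refine evalHom_ext fun x => ?_
  rw [map_charOp, charOp_self, charFun]
  split_ifs with h
  · exact (evalHom_indicator_of_mem h).symm
  · exact (evalHom_indicator_of_notMem h).symm

theorem infOp_indicator (X : SetD Ω D) (Y Z : Set X.carrier) :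
    infOp Ω D (indicator X Y) (indicator X Z) = indicator X (Y ∩ Z) := by
  refine evalHom_ext fun x => ?_
  rw [map_infOp, infOp_self]
  by_cases hY : x ∈ Y <;> by_cases hZ : x ∈ Z <;>
    simp [evalHom_indicator_of_mem, evalHom_indicator_of_notMem, hY, hZ]

theorem charOp_top_indicator [Nontrivial D] (X : SetD Ω D) (Y : Set X.carrier) :
    charOp Ω D ⊤ (indicator X Y) = indicator X Y := by
  rw [charOp_eq_indicator]
  congr 1
  ext x
  exact evalHom_indicator_eq_top

section Product

variable [Nontrivial D]

/-- The homomorphism `𝔖P'(X, v) → P(X)` sending `a` to the set of all points at which `a` has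
value `1`. -/
noncomputable def skelProd (X : SetD Ω D) :
    (skeleton Ω D).obj (prodObj X) ⟶ powersetFunctor.obj (op ((forgetD Ω D).obj X)) :=
  BoolAlg.ofHom (X := Skel (prodObj X)) (Y := Set X.carrier)
    { toFun := fun a => {x | Skel.point (evalHom X x) a}
      map_sup' := fun a b => Set.ext fun x => iff_of_eq (map_sup (Skel.point (evalHom X x)) a b)
      map_inf' := fun a b => Set.ext fun x => iff_of_eq (map_inf (Skel.point (evalHom X x)) a b)
      map_top' := Set.ext fun x => iff_of_eq (map_top (Skel.point (evalHom X x)))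
      map_bot' := Set.ext fun x => iff_of_eq (map_bot (Skel.point (evalHom X x))) }

theorem skelProd_naturality {X Y : SetD Ω D} (f : X ⟶ Y) :
    (skeleton Ω D).map (prodMap f) ≫ skelProd X =
      skelProd Y ≫ powersetFunctor.map ((forgetD Ω D).map f).op := rfl

instance (X : SetD Ω D) : IsIso (skelProd X) := by
  refine boolAlg_isIso_of_bijective _ ⟨fun a b h => ?_, fun Y => ?_⟩
  · exact Skel.ext (evalHom_ext fun x => Skel.map_eq_of_point (Set.ext_iff.1 h x))
  · exact ⟨⟨indicator X Y, charOp_top_indicator _ _⟩, Set.ext fun x => evalHom_indicator_eq_top⟩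

end Product

section BoolPower

variable [Finite D]

theorem valHom_eq_top_iff (S : Ω.Substructure D) (B : BoolAlg.{u}) (φ : BoundedLatticeHom B Prop)
    (ξ : BoolPower S B) : valHom S B φ ξ = ⊤ ↔ φ (ξ.toFun (topElt S)) := by
  rw [← ξ.val_eq_iff]
  exact (Subtype.ext_iff (a1 := ξ.val φ) (a2 := topElt S)).symm

omit [Lattice D] [BoundedOrder D] [IsSemiPrimal Ω D]
  [HasBoundedLatticeReduct Ω D] in
theorem valHom_boolPowerMap {S S' : Ω.Substructure D} (h : S ≤ S') {B B' : BoolAlg.{u}}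
    (f : B ⟶ B') (φ : BoundedLatticeHom B' Prop) (ξ : boolPower S B) :
    valHom S' B' φ (Var.hom (boolPowerMap h f) ξ) = valHom S B (φ.comp f.hom) ξ :=
  coe_val_boolPowerMap h f ξ φ

theorem boolPowerMap_toFun_top {S S' : Ω.Substructure D} (h : S ≤ S') {B B' : BoolAlg.{u}}
    (f : B ⟶ B') (ξ : BoolPower S B) :
    (show BoolPower S' B' from Var.hom (boolPowerMap h f) ξ).toFun (topElt S') =
      f (ξ.toFun (topElt S)) :=
  eq_of_points fun φ => by
    rw [← valHom_eq_top_iff S' B' φ]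
    exact (iff_of_eq (congrArg (· = ⊤) (valHom_boolPowerMap h f φ ξ))).trans
      (valHom_eq_top_iff S B _ ξ)

omit [Lattice D] [BoundedOrder D] [IsSemiPrimal Ω D]
  [HasBoundedLatticeReduct Ω D] in
/-- Boolean powers preserve injectivity, in the algebra and in the subalgebra of `D`. -/
theorem boolPowerMap_injective {S S' : Ω.Substructure D} (h : S ≤ S') {B B' : BoolAlg.{u}}
    (f : B ⟶ B') (hf : Function.Injective f) :
    Function.Injective (Var.hom (boolPowerMap h f)) := by
  intro (ξ : BoolPower S B) (ζ : BoolPower S B) hξ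
  refine BoolPower.ext_toFun (funext fun s => hf (eq_of_points fun φ => ?_))
  have h' : ξ.val (φ.comp f.hom) = ζ.val (φ.comp f.hom) :=
    Subtype.ext (((valHom_boolPowerMap h f φ ξ).symm.trans (congrArg (valHom S' B' φ) hξ)).trans
      (valHom_boolPowerMap h f φ ζ))
  change (φ.comp f.hom) (ξ.toFun s) ↔ (φ.comp f.hom) (ζ.toFun s)
  rw [← ξ.val_eq_iff, ← ζ.val_eq_iff, h']

theorem thetaInv_injective (S : Ω.Substructure D) (X : Type u) :
    Function.Injective (Var.hom (thetaInv S X)) := by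
  intro (ξ : BoolPower S (Set X)) (ζ : BoolPower S (Set X)) h
  refine BoolPower.ext_toFun (funext fun s => Set.ext fun x => ?_)
  rw [mem_iff_thetaInv S X, mem_iff_thetaInv S X, h]

variable [Nontrivial D]

open scoped Classical in
/-- The element of the Boolean power `S[B]` with value `1` exactly on `b`, and value `0` on the
complement of `b`. -/
noncomputable def charElt (S : Ω.Substructure D) {B : BoolAlg.{u}} (b : B) : BoolPower S B :=
  have key : ∀ φ : BoundedLatticeHom B Prop,
      ∃! s : S, φ (if s = topElt S then b else if s = botElt S then bᶜ else ⊥) := by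
    intro φ
    by_cases hb : φ b
    · refine ⟨topElt S, by simpa using hb, fun s hs => ?_⟩
      dsimp only at hs
      split_ifs at hs with h1 h2
      · exact h1
      · rw [map_compl'] at hs
        exact (hs hb).elim
      · rw [map_bot] at hs
        exact hs.elim
    · refine ⟨botElt S, ?_, fun s hs => ?_⟩
      · dsimp only
        rw [if_neg (topElt_ne_botElt S).symm, if_pos rfl, map_compl']
        exact hb
      · dsimp only at hs
        split_ifs at hs with h1 h2
        · exact (hb hs).elim
        · exact h2
        · rw [map_bot] at hs
          exact hs.elim
  { toFun := fun s => if s = topElt S then b else if s = botElt S then bᶜ else ⊥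
    disjoint := (BoolPower.of_existsUnique key).1
    cover := (BoolPower.of_existsUnique key).2 }

omit [Ω.IsAlgebraic] in
theorem charElt_toFun_top (S : Ω.Substructure D) {B : BoolAlg.{u}} (b : B) :
    (charElt S b).toFun (topElt S) = b := if_pos rfl

open scoped Classical in
theorem valHom_charElt_eq_bot (S : Ω.Substructure D) {B : BoolAlg.{u}} (b : B)
    (φ : BoundedLatticeHom B Prop) (hb : ¬ φ b) : valHom S B φ (charElt S b) = ⊥ := by
  have : (charElt S b).val φ = botElt S := by
    rw [BoolPower.val_eq_iff]
    change φ (if _ then _ else _)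
    rw [if_neg (topElt_ne_botElt S).symm, if_pos rfl, map_compl']
    exact hb
  exact congrArg Subtype.val this

theorem charOp_top_charElt (S : Ω.Substructure D) {B : BoolAlg.{u}} (b : B) :
    charOp Ω D ⊤ (show boolPower S B from charElt S b) = charElt S b := by
  refine BoolPower.ext_coe_val (S := S) (B := B) fun φ => ?_
  change valHom S B φ _ = valHom S B φ _
  rw [map_charOp, charOp_self]
  by_cases hb : φ b
  · have := (valHom_eq_top_iff S B φ (charElt S b)).2 (by rwa [charElt_toFun_top])
    rw [this, charFun_top_top]
  · rw [valHom_charElt_eq_bot S b φ hb, charFun_top_bot]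

theorem point_toFun_top (S : Ω.Substructure D) {B : BoolAlg.{u}} (φ : BoundedLatticeHom B Prop)
    (a : Skel (boolPower S B)) :
    φ (BoolPower.toFun a.val (topElt S)) = Skel.point (valHom S B φ) a :=
  propext (valHom_eq_top_iff S B φ a.val).symm

/-- The homomorphism `𝔖𝔓_S(B) → B` sending `ξ` to `ξ(1)`. -/
noncomputable def skelBoolPower (S : Ω.Substructure D) (B : BoolAlg.{u}) :
    (skeleton Ω D).obj (((boolPowerFunctor Ω D).obj S).obj B) ⟶ B :=
  BoolAlg.ofHom (X := Skel (boolPower S B)) (Y := B)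
    { toFun := fun a => BoolPower.toFun a.val (topElt S)
      map_sup' := fun a b => eq_of_points fun φ => by
        rw [map_sup, point_toFun_top, point_toFun_top, point_toFun_top, map_sup]
      map_inf' := fun a b => eq_of_points fun φ => by
        rw [map_inf, point_toFun_top, point_toFun_top, point_toFun_top, map_inf]
      map_top' := eq_of_points fun φ => by rw [point_toFun_top, map_top, map_top]
      map_bot' := eq_of_points fun φ => by rw [point_toFun_top, map_bot, map_bot] }

theorem skelBoolPower_naturality (S : Ω.Substructure D) {B B' : BoolAlg.{u}} (f : B ⟶ B') :
    (skeleton Ω D).map (((boolPowerFunctor Ω D).obj S).map f) ≫ skelBoolPower S B' =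
      skelBoolPower S B ≫ f :=
  BoolAlg.ext fun a => boolPowerMap_toFun_top le_rfl f a.val

instance (S : Ω.Substructure D) (B : BoolAlg.{u}) : IsIso (skelBoolPower S B) := by
  refine boolAlg_isIso_of_bijective _ ⟨fun (a b : Skel (boolPower S B)) h => ?_,
    fun b => ?_⟩
  · refine Skel.ext (BoolPower.ext_coe_val (S := S) (B := B) fun φ => ?_)
    refine Skel.map_eq_of_point (u := valHom S B φ) (u' := valHom S B φ) (iff_of_eq ?_)
    rw [← point_toFun_top, ← point_toFun_top]
    exact congrArg φ h
  · exact ⟨⟨charElt S b, charOp_top_charElt S b⟩, charElt_toFun_top S b⟩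

/-- Under the identifications of the skeletons of `𝔓_S P` and `P' V^S` with `P`, the isomorphism
`𝔓_S P ≅ P' V^S` becomes the identity. -/
theorem skeleton_map_thetaInv (S : Ω.Substructure D) (X : Type u) :
    (skeleton Ω D).map (thetaInv S X) ≫ skelProd (((vFunctor Ω D).obj (op S)).obj X) =
      skelBoolPower S (powersetFunctor.obj (op X)) :=
  BoolAlg.ext fun a => Set.ext fun x =>
    Iff.trans (Subtype.ext_iff (a2 := topElt S)).symm
      (mem_iff_thetaInv S X a.val x (topElt S)).symm

end BoolPower

/-! ### The quotients of products of subalgebras -/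

section Quotient

variable [Nontrivial D]

omit [Ω.IsAlgebraic] in
theorem map_charOp_eq_top {A : Var Ω D} (u : A →[Ω] D) (a : A) :
    u (charOp Ω D (u a) a) = ⊤ := by
  rw [map_charOp, charOp_self, charFun_eq_top_iff]

omit [Nontrivial D] in
/-- The family of the sets whose characteristic function is sent to `1` by a homomorphism
`P'(X, v) → D` is closed under supersets. -/
theorem map_indicator_mono {X : SetD Ω D} (u : prodObj X →[Ω] D) {Y Z : Set X.carrier}
    (h : Y ⊆ Z) (hY : u (indicator X Y) = ⊤) : u (indicator X Z) = ⊤ := by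
  rw [← Set.inter_eq_left.2 h, ← infOp_indicator, map_infOp, infOp_self] at hY
  exact (inf_eq_top_iff.1 hY).2

/-- The filter of a homomorphism `u : P'(X, v) → D` with image in `S` contains `C^S (X, v)`: choose
`α` with `α(x) ∉ S` whenever `v(x) ≰ S`; then `α` takes the value `u(α) ∈ S` only on
`C^S (X, v)`. -/
theorem map_indicator_of_mem {S : Ω.Substructure D} {X : SetD Ω D} (u : prodObj X →[Ω] D)
    (hu : ∀ α, u α ∈ S) : u (indicator X {x | X.v x ≤ S}) = ⊤ := by
  have key : ∀ x, ∃ d : X.v x, (d : D) ∈ S → X.v x ≤ S := fun x => by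
    by_cases h : X.v x ≤ S
    · exact ⟨topElt _, fun _ => h⟩
    · obtain ⟨d, hd, hd'⟩ := SetLike.not_le_iff_exists.1 h
      exact ⟨⟨d, hd⟩, fun h => (hd' h).elim⟩
  choose α hα using key
  have h := map_charOp_eq_top u (show prodObj X from α)
  rw [charOp_eq_indicator] at h
  refine map_indicator_mono u (fun x hx => hα x ?_) h
  rw [show ((α x : X.v x) : D) = u (show prodObj X from α) from hx]
  exact hu _

/-- Elements of `P'(X, v)` which agree on `C^S (X, v)` are identified by `theta S`. -/
theorem theta_of_eqOn {S : Ω.Substructure D} {X : SetD Ω D} {α β : prodObj X}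
    (h : ∀ x, X.v x ≤ S → evalHom X x α = evalHom X x β) : theta S (prodObj X) α β := by
  intro u hu
  have h1 := map_charOp_eq_top u α
  rw [charOp_eq_indicator] at h1
  have h2 : u (indicator X ({x | evalHom X x α = u α} ∩ {x | X.v x ≤ S})) = ⊤ := by
    rw [← infOp_indicator, map_infOp, infOp_self, h1, map_indicator_of_mem u hu, inf_top_eq]
  have h3 : u (indicator X {x | evalHom X x β = u α}) = ⊤ :=
    map_indicator_mono u (fun x hx => (h x hx.2).symm.trans hx.1) h2
  rw [← charOp_eq_indicator, map_charOp, charOp_self, charFun_eq_top_iff] at h3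
  exact h3.symm

/-- `K_S P'(X, v) → P C^S (X, v)` is an isomorphism: it is injective because elements of
`P'(X, v)` which agree on `C^S (X, v)` have the same class, and surjective because characteristic
functions belong to the Boolean skeleton. -/
instance psiInv_isIso [Finite D] (S : Ω.Substructure D) (X : SetD Ω D) : IsIso (psiInv S X) := by
  refine boolAlg_isIso_of_bijective _ ⟨fun a b h => ?_, fun Y => ?_⟩
  · have h' : ∀ x (hx : X.v x ≤ S),
        evalQuot S X x hx (Skel.val a) = evalQuot S X x hx (Skel.val b) := fun x hx =>
      Skel.map_eq_of_point (Set.ext_iff.1 h ⟨x, hx⟩)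
    obtain ⟨a, ha⟩ := a
    obtain ⟨b, hb⟩ := b
    apply Skel.ext
    induction a using Quotient.inductionOn with
    | h α =>
      induction b using Quotient.inductionOn with
      | h β => exact Quotient.sound (theta_of_eqOn h')
  · let Z : Set X.carrier :=
      {x | ∃ hx : X.v x ≤ S, (⟨x, hx⟩ : {x // X.v x ≤ S}) ∈ (show Set _ from Y)}
    refine ⟨⟨thetaMk S (prodObj X) (indicator X Z), ?_⟩, Set.ext fun x => ?_⟩
    · have h := map_charOp Ω D (thetaMk S (prodObj X)) ⊤ (indicator X Z)
      rw [charOp_top_indicator] at h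
      exact h.symm
    · refine Iff.trans (b := evalHom X x.1 (indicator X Z) = ⊤) Iff.rfl ?_
      rw [evalHom_indicator_eq_top]
      exact ⟨fun h => h.2, fun h => ⟨x.2, h⟩⟩

end Quotient

end Skeletons

/-! ### Jointly monic families in the variety -/

section JointlyInjective

variable {Ω : FirstOrder.Language.{w, w'}} [Ω.IsAlgebraic] {D : Type u} [Ω.Structure D]

/-- A jointly monic family of homomorphisms in the variety is jointly injective: test against its
joint kernel, a subalgebra of the square. -/
theorem jointly_injective {A : Var Ω D} {ι : Type*} {B : ι → Var Ω D} (f : ∀ i, A ⟶ B i)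
    (hf : ∀ (C : Var Ω D) (g h : C ⟶ A), (∀ i, g ≫ f i = h ≫ f i) → g = h) {a b : A}
    (hab : ∀ i, Var.hom (f i) a = Var.hom (f i) b) : a = b := by
  let K : Ω.Substructure (ULift.{u} Bool → A) :=
    { carrier := {p | ∀ i, Var.hom (f i) (p ⟨true⟩) = Var.hom (f i) (p ⟨false⟩)}
      fun_mem := fun g x hx i => by
        rw [pi_funMap_apply, pi_funMap_apply, (Var.hom (f i)).map_fun, (Var.hom (f i)).map_fun]
        exact congrArg (funMap g) (funext fun k => hx k i) }
  let C : Var Ω D :=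
    { carrier := K
      mem := (InHSP.pi fun _ => A.mem).of_injective K.subtype.toHom Subtype.val_injective }
  let p (c : Bool) : C ⟶ A :=
    Var.ofHom (A := C) (homMk (A := K) (fun x => x.1 ⟨c⟩) fun _ _ _ => rfl)
  have h := hf C (p true) (p false) fun i => Var.ext fun (x : K) => x.2 i
  exact Var.congr_hom h (⟨fun c => bif c.down then a else b, hab⟩ : K)

end JointlyInjective

/-! ### The underlying set of the lifted functor -/

section LiftSet

variable {Ω : FirstOrder.Language.{w, w'}} {D : Type u} [Ω.Structure D]

theorem liftSetι_toFun_map (T : Type u ⥤ Type u) (X : SetD Ω D) {S S' : Ω.Substructure D}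
    (s : S ⟶ S') (t : T.obj (((cFunctor Ω D).obj S).obj X)) :
    (liftSetι T X S').toFun (T.map (((cFunctor Ω D).map s).app X) t) =
      (liftSetι T X S).toFun t :=
  (SetD.congr_toFun (coend.condition ((coendDiagram T).obj X) s) t).symm

/-- Maps out of the underlying set of `T'(X, v)` are determined by their composites with the coend
morphisms, as they are morphisms into a set all of whose points have the least subalgebra. -/
theorem liftSet_funext (T : Type u ⥤ Type u) (X : SetD Ω D) {Y : Type u}
    {f g : ((liftSet Ω D T).obj X).carrier → Y}
    (h : ∀ S t, f ((liftSetι T X S).toFun t) = g ((liftSetι T X S).toFun t)) : f = g := by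
  let Y' : SetD Ω D := ⟨Y, fun _ => ⊥⟩
  let f' : (liftSet Ω D T).obj X ⟶ Y' := ⟨f, fun _ => bot_le⟩
  let g' : (liftSet Ω D T).obj X ⟶ Y' := ⟨g, fun _ => bot_le⟩
  have h' : f' = g' := coend.hom_ext fun S => SetD.hom_ext (h S)
  exact congrArg SetD.Hom.toFun h'

/-- The coend defining `T'(X, v)` has the underlying set `T(C^D (X, v))`: apart from the
subalgebras assigned to the points, its diagram depends only on the covariant variable, and `D` is
the greatest subalgebra. -/
theorem liftSetι_top_bijective (T : Type u ⥤ Type u) (X : SetD Ω D) :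
    Function.Bijective (liftSetι T X ⊤).toFun := by
  constructor
  -- The maps `T(C^S) → T(C^D)` form a cowedge, whose factorization is a left inverse.
  · let Y : SetD Ω D := ⟨T.obj (((cFunctor Ω D).obj ⊤).obj X), fun _ => ⊥⟩
    let r : (liftSet Ω D T).obj X ⟶ Y :=
      coend.desc (F := (coendDiagram T).obj X)
        (fun S => (⟨fun t => T.map (((cFunctor Ω D).map (homOfLE le_top)).app X) t,
          fun _ => bot_le⟩ : SetD.Hom (((vFunctor Ω D).obj (op S)).obj _) Y))
        fun S S' s => SetD.hom_ext fun t =>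
          ConcreteCategory.congr_hom (T.map_comp (((cFunctor Ω D).map s).app X)
            (((cFunctor Ω D).map (homOfLE (le_top (a := S')))).app X)) t
    have hr : ∀ t, r.toFun ((liftSetι T X ⊤).toFun t) = t := fun t =>
      (SetD.congr_toFun (coend.ι_desc (F := (coendDiagram T).obj X) _ _ ⊤) t).trans
        (ConcreteCategory.congr_hom (T.map_id _) t)
    exact Function.LeftInverse.injective hr
  -- The indicator of the range agrees with `True` on the image of each coend morphism.
  · have h : (fun z => ULift.up.{u} (∃ t, (liftSetι T X ⊤).toFun t = z)) = fun _ => ⟨True⟩ :=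
      liftSet_funext T X fun S t => congrArg ULift.up (eq_true
        ⟨T.map (((cFunctor Ω D).map (homOfLE le_top)).app X) t, liftSetι_toFun_map T X _ t⟩)
    exact fun z => of_eq_true (congrArg ULift.down (congrFun h z))

/-- The isomorphism `X ≅ C^D (X, v)`. -/
def isoTop (X : SetD Ω D) : (forgetD Ω D).obj X ≅ ((cFunctor Ω D).obj ⊤).obj X where
  hom := TypeCat.ofHom fun x => ⟨x, le_top⟩
  inv := TypeCat.ofHom fun x => x.1

theorem isoTop_naturality {X Y : SetD Ω D} (f : X ⟶ Y) :
    (forgetD Ω D).map f ≫ (isoTop Y).hom = (isoTop X).hom ≫ ((cFunctor Ω D).obj ⊤).map f := rfl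

/-- The coend morphism at `D` as a map of sets, with source `T(C^D (X, v))` instead of the
underlying set of `V^D T C^D (X, v)`, to which it is definitionally equal. -/
noncomputable def carrierι (T : Type u ⥤ Type u) (X : SetD Ω D) :
    T.obj (((cFunctor Ω D).obj ⊤).obj X) ⟶ (forgetD Ω D).obj ((liftSet Ω D T).obj X) :=
  (forgetD Ω D).map (liftSetι T X ⊤)

theorem carrierι_naturality (T : Type u ⥤ Type u) {X Y : SetD Ω D} (f : X ⟶ Y) :
    T.map (((cFunctor Ω D).obj ⊤).map f) ≫ carrierι T Y =
      carrierι T X ≫ (forgetD Ω D).map ((liftSet Ω D T).map f) :=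
  (congrArg (forgetD Ω D).map (liftSetι_naturality T f ⊤)).symm

instance (T : Type u ⥤ Type u) (X : SetD Ω D) : IsIso (carrierι T X) :=
  (isIso_iff_bijective _).2 (liftSetι_top_bijective T X)

/-- The bijection from `T(X)` to the underlying set of `T'(X, v)`. -/
noncomputable def forgetLift (T : Type u ⥤ Type u) (X : SetD Ω D) :
    T.obj ((forgetD Ω D).obj X) ⟶ (forgetD Ω D).obj ((liftSet Ω D T).obj X) :=
  T.map (isoTop X).hom ≫ carrierι T X

theorem forgetLift_naturality (T : Type u ⥤ Type u) {X Y : SetD Ω D} (f : X ⟶ Y) :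
    T.map ((forgetD Ω D).map f) ≫ forgetLift T Y =
      forgetLift T X ≫ (forgetD Ω D).map ((liftSet Ω D T).map f) := by
  have h := congrArg T.map (isoTop_naturality f)
  rw [T.map_comp, T.map_comp] at h
  unfold forgetLift
  rw [reassoc_of% h, Category.assoc, carrierι_naturality]

instance (T : Type u ⥤ Type u) (X : SetD Ω D) : IsIso (forgetLift T X) :=
  inferInstanceAs (IsIso (T.map (isoTop X).hom ≫ carrierι T X))

end LiftSet

variable {Ω : FirstOrder.Language.{w, w'}} [Ω.IsAlgebraic] {D : Type u} [Ω.Structure D]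
  [Finite D] [Lattice D] [BoundedOrder D] [IsSemiPrimal Ω D] [HasBoundedLatticeReduct Ω D]

/-! ### The Boolean skeleton of the lifted functor -/

theorem liftAlg_ext (L : BoolAlg.{u} ⥤ BoolAlg.{u}) (A : Var Ω D) {a b : (liftAlg Ω D L).obj A}
    (h : ∀ S, Var.hom (liftAlgπ L A S) a = Var.hom (liftAlgπ L A S) b) : a = b :=
  jointly_injective (liftAlgπ L A) (fun _ _ _ h => end_.hom_ext h) h

/-- The morphisms `𝔓_⊥ L K_D (A) → 𝔓_S L K_S (A)` form a wedge, where `⊥` is the least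
subalgebra. -/
noncomputable def liftAlgSection (L : BoolAlg.{u} ⥤ BoolAlg.{u}) (A : Var Ω D) :
    boolPower ⊥ (L.obj (((kFunctor Ω D).obj (op ⊤)).obj A)) ⟶ (liftAlg Ω D L).obj A :=
  end_.lift (F := (endDiagram L).obj A)
    (fun S => boolPowerMap bot_le (L.map (((kFunctor Ω D).map (homOfLE le_top).op).app A)))
    fun S S' s => by
      refine (boolPowerMap_comp _ _ _ _).trans (Eq.trans ?_ (boolPowerMap_comp _ _ _ _).symm)
      rw [Category.comp_id, ← L.map_comp]
      refine congrArg (fun g => boolPowerMap bot_le (L.map g)) ?_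
      exact congrArg (NatTrans.app · A)
        ((kFunctor Ω D).map_comp (homOfLE (le_top (a := S'))).op s.op)

theorem liftAlgSection_π (L : BoolAlg.{u} ⥤ BoolAlg.{u}) (A : Var Ω D) (S : Ω.Substructure D) :
    liftAlgSection L A ≫ liftAlgπ L A S =
      boolPowerMap bot_le (L.map (((kFunctor Ω D).map (homOfLE le_top).op).app A)) :=
  end_.lift_π (F := (endDiagram L).obj A) _ _ S

/-- An element of `L'(A)` is determined by its component in `𝔓_D L K_D (A)`, as the inclusions
`𝔓_S ⇒ 𝔓_D` are injective. -/
theorem liftAlgπ_top_injective (L : BoolAlg.{u} ⥤ BoolAlg.{u}) (A : Var Ω D) :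
    Function.Injective (Var.hom (liftAlgπ L A ⊤)) := by
  intro a b h
  refine liftAlg_ext L A fun S => ?_
  have hc := fun c => Var.congr_hom (liftAlgπ_condition L A (homOfLE (le_top (a := S)))) c
  refine boolPowerMap_injective (le_top (a := S)) (𝟙 _) (fun _ _ h => h) ((hc a).trans ?_)
  refine Eq.trans ?_ (hc b).symm
  rw [Var.hom_comp, Var.hom_comp, h]

variable [Nontrivial D]

/-- The homomorphism `𝔖L'(A) → L K_D (A)`, by the end morphism at `D`. -/
noncomputable def skelLiftAlg (L : BoolAlg.{u} ⥤ BoolAlg.{u}) (A : Var Ω D) :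
    (skeleton Ω D).obj ((liftAlg Ω D L).obj A) ⟶ L.obj (((kFunctor Ω D).obj (op ⊤)).obj A) :=
  (skeleton Ω D).map (liftAlgπ L A ⊤) ≫ skelBoolPower ⊤ _

theorem skelLiftAlg_naturality (L : BoolAlg.{u} ⥤ BoolAlg.{u}) {A B : Var Ω D} (f : A ⟶ B) :
    (skeleton Ω D).map ((liftAlg Ω D L).map f) ≫ skelLiftAlg L B =
      skelLiftAlg L A ≫ L.map (((kFunctor Ω D).obj (op ⊤)).map f) := by
  have h := congrArg (skeleton Ω D).map (liftAlgπ_naturality L f ⊤)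
  rw [Functor.map_comp, Functor.map_comp] at h
  unfold skelLiftAlg
  rw [reassoc_of% h, skelBoolPower_naturality, Category.assoc]

/-- A section of `𝔖L'(A) → L K_D (A)`: an element `b` of `L K_D (A)` is the image of the
compatible family of the elements of `𝔓_S L K_S (A)` with value `1` on the image of `b` in
`L K_S (A)` and value `0` on its complement. -/
theorem skeleton_map_liftAlgSection (L : BoolAlg.{u} ⥤ BoolAlg.{u}) (A : Var Ω D) :
    (skeleton Ω D).map (liftAlgSection L A) ≫ skelLiftAlg L A = skelBoolPower ⊥ _ := by
  have h := congrArg (skeleton Ω D).map (liftAlgSection_π L A ⊤)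
  rw [Functor.map_comp] at h
  have hid : L.map (((kFunctor Ω D).map (homOfLE (le_top (a := ⊤))).op).app A) = 𝟙 _ :=
    (congrArg (fun g => L.map (NatTrans.app g A)) ((kFunctor Ω D).map_id (op ⊤))).trans
      (L.map_id _)
  rw [hid] at h
  unfold skelLiftAlg
  rw [reassoc_of% h]
  exact BoolAlg.ext fun a => boolPowerMap_toFun_top bot_le (𝟙 _) (Skel.val a)

instance (L : BoolAlg.{u} ⥤ BoolAlg.{u}) (A : Var Ω D) : IsIso (skelLiftAlg L A) := by
  refine boolAlg_isIso_of_bijective _ ⟨?_, fun b => ?_⟩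
  · exact (ConcreteCategory.bijective_of_isIso
      (skelBoolPower ⊤ (L.obj (((kFunctor Ω D).obj (op ⊤)).obj A)))).1.comp
      fun a b h => Skel.ext (liftAlgπ_top_injective L A (congrArg Skel.val h))
  · obtain ⟨c, hc⟩ := (ConcreteCategory.bijective_of_isIso
      (skelBoolPower (⊥ : Ω.Substructure D) (L.obj (((kFunctor Ω D).obj (op ⊤)).obj A)))).2 b
    rw [← skeleton_map_liftAlgSection] at hc
    exact ⟨_, hc⟩

/-- The homomorphism `K_D P'(X, v) → P(X)`. -/
noncomputable def kProd (X : SetD Ω D) :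
    ((kFunctor Ω D).obj (op ⊤)).obj (prodObj X) ⟶ powersetFunctor.obj (op ((forgetD Ω D).obj X)) :=
  psiInv ⊤ X ≫ powersetFunctor.map (isoTop X).hom.op

theorem kProd_naturality {X Y : SetD Ω D} (f : X ⟶ Y) :
    ((kFunctor Ω D).obj (op ⊤)).map (prodMap f) ≫ kProd X =
      kProd Y ≫ powersetFunctor.map ((forgetD Ω D).map f).op := by
  have h := psiInv_naturality ⊤ f
  have h' := congrArg (fun g => powersetFunctor.map g.op) (isoTop_naturality f)
  dsimp only [op_comp] at h'
  rw [Functor.map_comp, Functor.map_comp] at h'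
  unfold kProd
  rw [reassoc_of% h, Category.assoc, ← h']

instance (X : SetD Ω D) : IsIso (kProd X) :=
  inferInstanceAs (IsIso (psiInv (⊤ : Ω.Substructure D) X ≫ powersetFunctor.map (isoTop X).hom.op))

theorem skelLiftAlg_kProd_naturality (L : BoolAlg.{u} ⥤ BoolAlg.{u}) {X Y : SetD Ω D}
    (f : X ⟶ Y) :
    (skeleton Ω D).map ((liftAlg Ω D L).map (prodMap f)) ≫
        skelLiftAlg L (prodObj X) ≫ L.map (kProd X) =
      (skelLiftAlg L (prodObj Y) ≫ L.map (kProd Y)) ≫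
        L.map (powersetFunctor.map ((forgetD Ω D).map f).op) := by
  rw [reassoc_of% skelLiftAlg_naturality L (prodMap f), ← L.map_comp, kProd_naturality,
    L.map_comp, Category.assoc]

omit [Finite D] in
theorem skelProd_forgetLift_naturality (T : Type u ⥤ Type u) {X Y : SetD Ω D} (f : X ⟶ Y) :
    (skeleton Ω D).map (prodMap ((liftSet Ω D T).map f)) ≫
        skelProd ((liftSet Ω D T).obj X) ≫ powersetFunctor.map (forgetLift T X).op =
      (skelProd ((liftSet Ω D T).obj Y) ≫ powersetFunctor.map (forgetLift T Y).op) ≫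
        powersetFunctor.map (T.map ((forgetD Ω D).map f)).op := by
  rw [reassoc_of% skelProd_naturality ((liftSet Ω D T).map f), ← Functor.map_comp, ← op_comp,
    ← forgetLift_naturality, op_comp, Functor.map_comp, Category.assoc]

/-- The isomorphism `𝔖L'P'(X, v) ≅ LP(X)`. -/
noncomputable def skelLiftAlgProdIso (L : BoolAlg.{u} ⥤ BoolAlg.{u}) (X : SetD Ω D) :
    (skeleton Ω D).obj ((liftAlg Ω D L).obj (prodObj X)) ≅
      L.obj (powersetFunctor.obj (op ((forgetD Ω D).obj X))) :=
  asIso (skelLiftAlg L (prodObj X)) ≪≫ L.mapIso (asIso (kProd X))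

/-- The isomorphism `𝔖P'T'(X, v) ≅ PT(X)`. -/
noncomputable def skelProdLiftSetIso (T : Type u ⥤ Type u) (X : SetD Ω D) :
    (skeleton Ω D).obj (prodObj ((liftSet Ω D T).obj X)) ≅
      powersetFunctor.obj (op (T.obj ((forgetD Ω D).obj X))) :=
  asIso (skelProd ((liftSet Ω D T).obj X)) ≪≫
    powersetFunctor.mapIso (asIso (forgetLift T X)).op

variable (Ω D) in
/-- The natural isomorphism `𝔖L'P' ≅ LPU`. -/
noncomputable def skelLiftAlgNatIso (L : BoolAlg.{u} ⥤ BoolAlg.{u}) :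
    (prodFunctor Ω D ⋙ liftAlg Ω D L) ⋙ skeleton Ω D ≅
      (forgetD Ω D).op ⋙ powersetFunctor.{u} ⋙ L :=
  NatIso.ofComponents (fun X => skelLiftAlgProdIso L X.unop)
    fun f => skelLiftAlg_kProd_naturality L f.unop

variable (Ω D) in
/-- The natural isomorphism `𝔖P'T' ≅ PTU`. -/
noncomputable def skelLiftSetNatIso (T : Type u ⥤ Type u) :
    ((liftSet Ω D T).op ⋙ prodFunctor Ω D) ⋙ skeleton Ω D ≅
      (forgetD Ω D).op ⋙ T.op ⋙ powersetFunctor.{u} :=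
  NatIso.ofComponents (fun X => skelProdLiftSetIso T X.unop)
    fun f => skelProd_forgetLift_naturality T f.unop

/-! ### The lifting of the one-step semantics -/

variable {T : Type u ⥤ Type u}

theorem mono_liftDeltaApp (ℓ : CoalgebraicLogic powersetFunctor.{u} T) (hℓ : ℓ.IsOneStepComplete)
    (X : SetD Ω D) : Mono (liftDeltaApp ℓ X) := by
  refine ⟨fun f g h => end_.hom_ext fun S => ?_⟩
  have : Mono (thetaInv S (T.obj (((cFunctor Ω D).obj S).obj X))) :=
    mono_of_injective _ (thetaInv_injective S _)
  have : Mono (((boolPowerFunctor Ω D).obj S).map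
      (ℓ.δ.app (op (((cFunctor Ω D).obj S).obj X)))) := by
    have := hℓ (op (((cFunctor Ω D).obj S).obj X))
    exact mono_of_injective _ (boolPowerMap_injective _ _ (boolAlg_injective_of_mono _))
  have h' : f ≫ wedge ℓ X S = g ≫ wedge ℓ X S := by
    rw [← liftDeltaApp_fac, reassoc_of% h]
  unfold wedge at h'
  simp only [← Category.assoc, cancel_mono] at h'
  exact h'

/-- On Boolean skeletons, the `S`-component of the lifting of `δ` is `δ` at `C^S (X, v)`. -/
theorem skeleton_map_wedge (ℓ : CoalgebraicLogic powersetFunctor.{u} T) (X : SetD Ω D)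
    (S : Ω.Substructure D) :
    (skeleton Ω D).map (wedge ℓ X S) ≫
        skelProd (((vFunctor Ω D).obj (op S)).obj (T.obj (((cFunctor Ω D).obj S).obj X))) =
      (skeleton Ω D).map (liftAlgπ ℓ.L (prodObj X) S) ≫ skelBoolPower S _ ≫
        ℓ.L.map (psiInv S X) ≫ ℓ.δ.app (op (((cFunctor Ω D).obj S).obj X)) := by
  have h1 := skelBoolPower_naturality S (ℓ.L.map (psiInv S X))
  have h2 := skelBoolPower_naturality S (ℓ.δ.app (op (((cFunctor Ω D).obj S).obj X)))
  have h3 := skeleton_map_thetaInv S (T.obj (((cFunctor Ω D).obj S).obj X))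
  unfold wedge
  simp only [Functor.map_comp, Category.assoc]
  rw [h3, ← reassoc_of% h1]
  exact congrArg (fun g => _ ≫ _ ≫ g) h2

/-- `δ'` restricts to `δ` on Boolean skeletons. -/
theorem skeleton_map_liftDeltaApp (ℓ : CoalgebraicLogic powersetFunctor.{u} T) (X : SetD Ω D) :
    (skeleton Ω D).map (liftDeltaApp ℓ X) ≫ skelProd ((liftSet Ω D T).obj X) ≫
        powersetFunctor.map (forgetLift T X).op =
      (skelLiftAlg ℓ.L (prodObj X) ≫ ℓ.L.map (kProd X)) ≫ ℓ.δ.app (op ((forgetD Ω D).obj X)) := by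
  have h1 := congrArg (skeleton Ω D).map (liftDeltaApp_fac ℓ X ⊤)
  rw [Functor.map_comp] at h1
  have h2 := skelProd_naturality (liftSetι T X ⊤)
  have h3 : ℓ.L.map (powersetFunctor.map (isoTop X).hom.op) ≫ ℓ.δ.app (op ((forgetD Ω D).obj X)) =
      ℓ.δ.app (op (((cFunctor Ω D).obj ⊤).obj X)) ≫
        powersetFunctor.map (T.map (isoTop X).hom).op := ℓ.δ.naturality (isoTop X).hom.op
  have h4 : powersetFunctor.map (forgetLift T X).op =
      powersetFunctor.map ((forgetD Ω D).map (liftSetι T X ⊤)).op ≫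
        powersetFunctor.map (T.map (isoTop X).hom).op := rfl
  rw [h4, ← reassoc_of% h2, reassoc_of% h1, reassoc_of% skeleton_map_wedge ℓ X ⊤]
  unfold skelLiftAlg kProd
  simp only [Functor.map_comp, Category.assoc]
  rw [h3]
  exact (Category.assoc _ _ _).trans (congrArg (_ ≫ ·)
    ((Category.assoc _ _ _).trans (congrArg (_ ≫ ·) (Category.assoc _ _ _))))

end SemiPrimal

theorem theorem4p6
    (Ω : FirstOrder.Language.{w, w'}) [Ω.IsAlgebraic]
    (D : Type u) [Ω.Structure D] [Finite D] [Lattice D] [BoundedOrder D] [Nontrivial D]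
    [SemiPrimal.IsSemiPrimal Ω D] [SemiPrimal.HasBoundedLatticeReduct Ω D]
    (T : Type u ⥤ Type u) [T.PreservesMonomorphisms] [T.PreservesEpimorphisms]
    (ℓ : SemiPrimal.CoalgebraicLogic SemiPrimal.powersetFunctor.{u} T)
    [ℓ.L.PreservesMonomorphisms] [ℓ.L.PreservesEpimorphisms] :
    (ℓ.IsOneStepComplete → (ℓ.lift Ω D).IsOneStepComplete) ∧
    ∃ (α : (SemiPrimal.prodFunctor Ω D ⋙ (ℓ.lift Ω D).L) ⋙ SemiPrimal.skeleton Ω D ≅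
          (SemiPrimal.forgetD Ω D).op ⋙ SemiPrimal.powersetFunctor.{u} ⋙ ℓ.L)
      (β : ((SemiPrimal.liftSet Ω D T).op ⋙ SemiPrimal.prodFunctor Ω D) ⋙
          SemiPrimal.skeleton Ω D ≅
          (SemiPrimal.forgetD Ω D).op ⋙ T.op ⋙ SemiPrimal.powersetFunctor.{u}),
      Functor.whiskerRight (ℓ.lift Ω D).δ (SemiPrimal.skeleton Ω D) ≫ β.hom =
        α.hom ≫ Functor.whiskerLeft (SemiPrimal.forgetD Ω D).op ℓ.δ := by
  exact ⟨fun h X => SemiPrimal.mono_liftDeltaApp ℓ h X.unop,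
    SemiPrimal.skelLiftAlgNatIso Ω D ℓ.L, SemiPrimal.skelLiftSetNatIso Ω D T,
    NatTrans.ext (funext fun X => SemiPrimal.skeleton_map_liftDeltaApp ℓ X.unop)⟩
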